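/- \textbf{Setting.} Let $(P_\theta)_{\theta\in\Theta}$ be a family of probability measures on a measurable space $(\mathcal X,\mathcal A)$ and fix $\theta\in\Theta$. Let $\dot\Theta_\theta$ (the tangent set) be a subset of a real Hilbert space $E$ such that each $b\in\dot\Theta_\theta$ is associated to a path $[0,\tau_b)\ni t\mapsto\theta_t=\theta_t^{(b)}\in\Theta$ with $\theta_0=\theta$ and $\tau_b>0$. Let $L^2_0(P_\theta)=\{g\in L^2(P_\theta):\int g\,dP_\theta=0\}$ with the scalar product of $L^2(P_\theta)$. \textbf{Hellinger regularity.} A continuous linear operator $A_\theta:\operatorname{lin}\dot\Theta_\theta\to L^2_0(P_\theta)$ is given (where $\operatorname{lin}\dot\Theta_\theta\subseteq E$ is the linear span) such that for every $b\in\dot\Theta_\theta$ $$\int\Big(\frac{dP_{\theta_t}^{1/2}-dP_\theta^{1/2}}{t}-\frac12\,A_\theta b\;dP_\theta^{1/2}\Big)^2\to0\qquad\text{as }t\downarrow0,$$ where $dP_{\theta_t}$ and $dP_\theta$ denote densities with respect to a measure $\mu$ dominating $P_{\theta_t}$ and $P_\theta$ (for instance $\mu=P_\theta+P_{\theta_t}$),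 and the integral, which does not depend on $\mu$, is with respect to $\mu$. \textbf{Locally regular indirect model.} A sequence of statistical experiments $(\mathcal X_n,\mathcal A_n,P_{n,\vartheta}:\vartheta\in\Theta)_{n\ge1}$ is called a locally regular indirect model at $\theta$ with respect to $\dot\Theta_\theta$, with Hilbert space $H$, rate $r_n>0$, $r_n\downarrow0$, and generalized score operator $A:\operatorname{lin}\dot\Theta_\theta\to H$ (continuous and linear), if there is a centered Gaussian process $(G(h))_{h\in\operatorname{ran}A}$ with covariance $\mathbb E[G(h_1)G(h_2)]=\langle h_1,h_2\rangle_H$ such that for every $b\in\dot\Theta_\theta$ with associated path $t\mapsto\theta_t$ there are $[-\infty,\infty]$-valued random variables $(G_n(h))_{h\in\operatorname{ran}A}$ on $\mathcal X_n$, $n\ge1$, with $$\log\frac{dP_{n,\theta_{r_n}}}{dP_{n,\theta}}=G_n(Ab)-\frac12\|Ab\|_H^2\qquad P_{n,\theta}\text{-a.s., for all }n\text{ with }r_n<\tau_b,$$ and, for all $k\in\mathbb N$ and $h_1,\dots,h_k\in\operatorname{ran}A$, the law of $(G_n(h_1),\dots,G_n(h_k))$ under $P_{n,\theta}$ converges weakly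 to the law of $(G(h_1),\dots,G(h_k))$ as $n\to\infty$. Here $dP_{n,\theta_{r_n}}/dP_{n,\theta}$ is the density of the absolutely continuous part of $P_{n,\theta_{r_n}}$ with respect to $P_{n,\theta}$, and $\log0=-\infty$. \textbf{Lemma.} If $(P_\theta)_{\theta\in\Theta}$ is Hellinger regular at $\theta$ with respect to $\dot\Theta_\theta$ with score operator $A_\theta$, then the product model $(\mathcal X^n,\mathcal A^{\otimes n},P_\vartheta^{\otimes n}:\vartheta\in\Theta)_{n\ge1}$ is a locally regular indirect model at $\theta$ with respect to the tangent set $\dot\Theta_\theta$, with Hilbert space $H=L^2_0(P_\theta)$, rate $r_n=n^{-1/2}$ and generalized score operator $A_\theta$. -/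

import Mathlib

open MeasureTheory ProbabilityTheory Filter Topology
open scoped ENNReal

universe w

noncomputable section

/-- A tangent set at `θ`: a set `dirs` of directions in a space `E` (a Hilbert space in the
theorem), each direction `b` being associated to a path `[0, τ) ∋ t ↦ θ_t ∈ Θ` with `θ_0 = θ`,
for some `τ = horizon b > 0`.  The path is stored as a function on `ℝ`, but only its values on
`[0, horizon b)` have a meaning. -/
structure TangentSet {Θ : Type*} (θ : Θ) (E : Type*) where
  dirs : Set E
  horizon : dirs → ℝ
  horizon_pos : ∀ b, 0 < horizon b
  path : dirs → ℝ → Θ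
  path_zero : ∀ b, path b 0 = θ

namespace TangentSet

variable {Θ : Type*} {θ : Θ} {E : Type*} [NormedAddCommGroup E] [InnerProductSpace ℝ E]

/-- The linear span of the tangent set, with the norm inherited from `E`. -/
abbrev lin (T : TangentSet θ E) : Submodule ℝ E := Submodule.span ℝ T.dirs

/-- A direction, seen as an element of the linear span. -/
def toLin (T : TangentSet θ E) (b : T.dirs) : T.lin := ⟨b, Submodule.subset_span b.2⟩

end TangentSet

/-- `L²₀(P)`: the square integrable functions `g` with `∫ g dP = 0`, with the norm and the inner
product of `L²(P)`. -/
def L20 {𝒳 : Type*} [MeasurableSpace 𝒳] (P : Measure 𝒳) [IsFiniteMeasure P] :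
    Submodule ℝ (Lp ℝ 2 P) where
  carrier := {g | ∫ x, g x ∂P = 0}
  add_mem' := by
    intro f g hf hg
    have hf' : Integrable f P := (Lp.memLp f).integrable (by norm_num)
    have hg' : Integrable g P := (Lp.memLp g).integrable (by norm_num)
    have h : ∫ x, (f + g : Lp ℝ 2 P) x ∂P = ∫ x, (f x + g x) ∂P :=
      integral_congr_ae (Lp.coeFn_add f g)
    simp only [Set.mem_ofPred_eq] at hf hg ⊢
    rw [h, integral_add hf' hg', hf, hg, add_zero]
  zero_mem' := by
    have h : ∫ x, (0 : Lp ℝ 2 P) x ∂P = ∫ _, (0 : ℝ) ∂P :=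
      integral_congr_ae (Lp.coeFn_zero ℝ 2 P)
    simp only [Set.mem_ofPred_eq]
    rw [h, integral_zero]
  smul_mem' := by
    intro c f hf
    have h : ∫ x, (c • f : Lp ℝ 2 P) x ∂P = ∫ x, c * f x ∂P :=
      integral_congr_ae (Lp.coeFn_smul c f)
    simp only [Set.mem_ofPred_eq] at hf ⊢
    rw [h, integral_const_mul, hf, mul_zero]

theorem mem_L20 {𝒳 : Type*} [MeasurableSpace 𝒳] {P : Measure 𝒳} [IsFiniteMeasure P]
    {g : Lp ℝ 2 P} : g ∈ L20 P ↔ ∫ x, g x ∂P = 0 := Iff.rfl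

theorem isClosed_L20 {𝒳 : Type*} [MeasurableSpace 𝒳] (P : Measure 𝒳) [IsFiniteMeasure P] :
    IsClosed (L20 P : Set (Lp ℝ 2 P)) := by
  have h : (L20 P : Set (Lp ℝ 2 P)) = {g | inner ℝ (indicatorConstLp 2 MeasurableSet.univ
      (measure_ne_top P Set.univ) (1 : ℝ)) g = 0} := by
    ext g
    rw [SetLike.mem_coe, mem_L20, Set.mem_ofPred_eq,
      L2.inner_indicatorConstLp_one MeasurableSet.univ (measure_ne_top P Set.univ) g,
      setIntegral_univ]
  rw [h]
  exact isClosed_eq (by fun_prop) continuous_const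

instance {𝒳 : Type*} [MeasurableSpace 𝒳] (P : Measure 𝒳) [IsFiniteMeasure P] :
    CompleteSpace (L20 P) :=
  (isClosed_L20 P).completeSpace_coe

/-- The integral `∫ ((dQ^{1/2} - dP^{1/2}) / t - (1/2) g dP^{1/2})²`, computed with the densities
of `P` and `Q` with respect to the dominating measure `μ`. -/
def hellingerIntegral {𝒳 : Type*} [MeasurableSpace 𝒳] (μ P Q : Measure 𝒳) (t : ℝ) (g : 𝒳 → ℝ) :
    ℝ≥0∞ :=
  ∫⁻ x, ENNReal.ofReal (((√(Q.rnDeriv μ x).toReal - √(P.rnDeriv μ x).toReal) / t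
    - 1 / 2 * g x * √(P.rnDeriv μ x).toReal) ^ 2) ∂μ

/-- Hellinger regularity of the family `(P θ)` at `θ` with respect to the tangent set `T`, with
score operator `A : lin T → L²₀(P_θ)`.  The integral does not depend on the (σ-finite) dominating
measure; here it is taken with respect to `P_θ + P_{θ_t}`, which dominates `P_θ` and `P_{θ_t}`. -/
def HellingerRegular {Θ 𝒳 E : Type*} [MeasurableSpace 𝒳]
    [NormedAddCommGroup E] [InnerProductSpace ℝ E]
    (P : Θ → Measure 𝒳) [∀ θ, IsProbabilityMeasure (P θ)] {θ : Θ} (T : TangentSet θ E)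
    (A : T.lin →L[ℝ] L20 (P θ)) : Prop :=
  ∀ b : T.dirs, Tendsto
    (fun t : ℝ => hellingerIntegral (P θ + P (T.path b t)) (P θ) (P (T.path b t)) t
      (A (T.toLin b) : Lp ℝ 2 (P θ)))
    (𝓝[>] 0) (𝓝 0)

/-- `Z` is a centered Gaussian process indexed by the subset `S` of a Hilbert space, with
covariance `E[Z(h₁) Z(h₂)] = ⟨h₁, h₂⟩`. -/
structure IsIsonormalOn {H Ω : Type*} [NormedAddCommGroup H] [InnerProductSpace ℝ H]
    [MeasurableSpace Ω] (S : Set H) (Z : S → Ω → ℝ) (P : Measure Ω) : Prop where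
  isGaussianProcess : IsGaussianProcess Z P
  centered : ∀ h, ∫ ω, Z h ω ∂P = 0
  covariance : ∀ h₁ h₂ : S, ∫ ω, Z h₁ ω * Z h₂ ω ∂P = inner ℝ (h₁ : H) (h₂ : H)

/-- The sequence of statistical experiments `(Ω n, P n θ : θ ∈ Θ)`, `n = 1, 2, …`, is a locally
regular indirect model at `θ` with respect to the tangent set `T`, with Hilbert space `H`,
rate `r` and generalized score operator `A : lin T → H`.

The log-likelihood ratio `log (dP_{n,θ_{r_n}} / dP_{n,θ})` is `-∞` where the density (of the
absolutely continuous part) vanishes, so the random variables `G n h` take values in the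
extended reals; their limits in distribution are real.  The equation for the log-likelihood
ratio makes sense when `r n` lies in the domain `[0, τ)` of the path, hence for all large `n`. -/
structure IsLocallyRegularIndirectModel {Θ E : Type*} {H : Type w}
    [NormedAddCommGroup E] [InnerProductSpace ℝ E]
    [NormedAddCommGroup H] [InnerProductSpace ℝ H] [CompleteSpace H]
    {Ω : ℕ+ → Type*} [∀ n, MeasurableSpace (Ω n)]
    (P : ∀ n, Θ → Measure (Ω n)) [∀ n θ, IsProbabilityMeasure (P n θ)]
    {θ : Θ} (T : TangentSet θ E) (r : ℕ+ → ℝ) (A : T.lin →L[ℝ] H) : Prop where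
  rate_pos : ∀ n, 0 < r n
  rate_antitone : Antitone r
  rate_tendsto : Tendsto r atTop (𝓝 0)
  lain : ∃ (Ω' : Type w) (_ : MeasurableSpace Ω') (P' : Measure Ω') (_ : IsProbabilityMeasure P')
    (Z : Set.range A → Ω' → ℝ), IsIsonormalOn (Set.range A) Z P' ∧
    ∀ b : T.dirs, ∃ G : ∀ n, Set.range A → Ω n → EReal,
      (∀ n h, Measurable (G n h)) ∧
      (∀ n, r n < T.horizon b → ∀ᵐ ω ∂(P n θ),
        ENNReal.log ((P n (T.path b (r n))).rnDeriv (P n θ) ω)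
          = G n ⟨A (T.toLin b), Set.mem_range_self _⟩ ω
            - ((1 / 2 * ‖A (T.toLin b)‖ ^ 2 : ℝ) : EReal)) ∧
      ∀ (k : ℕ) (h : Fin k → Set.range A),
        TendstoInDistribution (fun n ω (j : Fin k) => G n (h j) ω) atTop
          (fun ω' (j : Fin k) => ((Z (h j) ω' : ℝ) : EReal)) (fun n => P n θ) P'

/-- The product model `(𝒳^n, P_θ^{⊗n})`, `n = 1, 2, …`, of `n` i.i.d. observations. -/
abbrev productModel {Θ 𝒳 : Type*} [MeasurableSpace 𝒳] (P : Θ → Measure 𝒳) (n : ℕ+) (θ : Θ) :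
    Measure (Fin n → 𝒳) :=
  Measure.pi fun _ => P θ

end

/-! Let `P = P_θ`, let `Q_n` be the alternative at `t = n^{-1/2}`, `g = A b`, and `W = 2(√(dQ_n/dP)
- 1)`, with `W_i` its value at the `i`-th observation `X_i`. Hellinger regularity implies that `√n W
→ g` in `L²(P)` and that the part of `Q_n` singular to `P` has mass `o(1/n)`. Since `log(dQ_n/dP) =
2 log(1 + W/2) = W - W²/4 + O(|W|³)`, the log-likelihood ratio of `n` observations is governed by
three facts under `P`: `∑ W_i = n^{-1/2} ∑ g(X_i) - ‖g‖²/4 + o_P(1)`, as the difference has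
vanishing variance and its mean is fixed by the total mass of `Q_n`
(`tendstoInMeasure_sum_rootScore`); `∑ W_i² → ‖g‖²` in probability, by the law of large numbers
(`tendstoInMeasure_sum_rootScore_sq`); `max |W_i| → 0` in probability, which removes the cubic
remainder (`tendsto_measure_exists_rootScore_gt`). Hence the log-likelihood ratio is `n^{-1/2} ∑
g(X_i) - ‖g‖²/2 + o_P(1)`.

The variables `G_n(h)` may depend on the direction `b`. They are the normalized sums of `h`, except
at `h = g`, where the required identity serves as the definition. By the expansion this changes the
vector only by `o_P(1)`, so the multivariate central limit theorem gives the isonormal limit. Only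
laws under `P` matter, so all limits are computed on the single space `P^ℕ`; the value `-∞` has
probability tending to `0`. -/

/-! ### Construction of isonormal Gaussian processes. -/

/-- The coordinates of an infinite product of standard Gaussian measures, as elements of `L²`. -/
noncomputable def gaussianCoord {ι : Type*} (i : ι) :
    Lp ℝ 2 (Measure.infinitePi fun _ : ι => gaussianReal 0 1) :=
  MemLp.toLp (fun ω => ω i) <| by
    have h := (memLp_id_gaussianReal (μ := 0) (v := 1) 2).comp_measurePreserving
      (measurePreserving_eval_infinitePi (fun _ : ι => gaussianReal 0 1) i)
    exact h

theorem gaussianCoord_coeFn {ι : Type*} (i : ι) :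
    gaussianCoord i =ᵐ[Measure.infinitePi fun _ : ι => gaussianReal 0 1] fun ω => ω i :=
  MemLp.coeFn_toLp _

theorem hasLaw_eval_infinitePi_gaussianReal {ι : Type*} (i : ι) :
    HasLaw (fun ω : ι → ℝ => ω i) (gaussianReal 0 1)
      (Measure.infinitePi fun _ : ι => gaussianReal 0 1) :=
  (measurePreserving_eval_infinitePi (fun _ : ι => gaussianReal 0 1) i).hasLaw

theorem iIndepFun_eval_infinitePi_gaussianReal (ι : Type*) :
    iIndepFun (fun (i : ι) (ω : ι → ℝ) => ω i)
      (Measure.infinitePi fun _ : ι => gaussianReal 0 1) :=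
  iIndepFun_infinitePi (P := fun _ : ι => gaussianReal 0 1) (X := fun _ x => x)
    fun _ => measurable_id

theorem integral_eval_infinitePi_gaussianReal {ι : Type*} (i : ι) :
    ∫ ω, ω i ∂(Measure.infinitePi fun _ : ι => gaussianReal 0 1) = 0 := by
  rw [(hasLaw_eval_infinitePi_gaussianReal i).integral_eq]
  exact integral_id_gaussianReal

theorem orthonormal_gaussianCoord (ι : Type*) : Orthonormal ℝ (gaussianCoord (ι := ι)) := by
  classical
  rw [orthonormal_iff_ite]
  intro i j
  rw [L2.inner_def]
  have h : ∫ ω, inner ℝ (gaussianCoord i ω) (gaussianCoord j ω)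
        ∂(Measure.infinitePi fun _ : ι => gaussianReal 0 1)
      = ∫ ω, ω i * ω j ∂(Measure.infinitePi fun _ : ι => gaussianReal 0 1) := by
    refine integral_congr_ae ?_
    filter_upwards [gaussianCoord_coeFn i, gaussianCoord_coeFn j] with ω hi hj
    rw [hi, hj]
    simp [mul_comm]
  rw [h]
  split_ifs with hij
  · subst hij
    have h1 := (hasLaw_eval_infinitePi_gaussianReal i).variance_eq
    rw [variance_of_integral_eq_zero (measurable_pi_apply i).aemeasurable (integral_eval_infinitePi_gaussianReal i),
      variance_id_gaussianReal] at h1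
    simpa [pow_two] using h1
  · have h1 := ((iIndepFun_eval_infinitePi_gaussianReal ι).indepFun hij).integral_fun_mul_eq_mul_integral
      (measurable_pi_apply i).aestronglyMeasurable (measurable_pi_apply j).aestronglyMeasurable
    rw [h1, integral_eval_infinitePi_gaussianReal, zero_mul]

/-- The linear isometry from a Hilbert space with Hilbert basis `b` to `L²` of a Gaussian product
space which sends `b i` to the `i`-th coordinate. -/
noncomputable def gaussianIsometry {ι H : Type*} [NormedAddCommGroup H] [InnerProductSpace ℝ H]
    (b : HilbertBasis ι ℝ H) :
    H →ₗᵢ[ℝ] Lp ℝ 2 (Measure.infinitePi fun _ : ι => gaussianReal 0 1) :=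
  (orthonormal_gaussianCoord ι).orthogonalFamily.linearIsometry.comp b.repr.toLinearIsometry

theorem gaussianIsometry_basis {ι H : Type*} [NormedAddCommGroup H] [InnerProductSpace ℝ H]
    (b : HilbertBasis ι ℝ H) (i : ι) : gaussianIsometry b (b i) = gaussianCoord i := by
  classical
  change (orthonormal_gaussianCoord ι).orthogonalFamily.linearIsometry (b.repr (b i)) = _
  rw [b.repr_self, OrthogonalFamily.linearIsometry_apply_single]
  simp

theorem integral_mul_gaussianIsometry {ι H : Type*} [NormedAddCommGroup H] [InnerProductSpace ℝ H]
    (b : HilbertBasis ι ℝ H) (h₁ h₂ : H) :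
    ∫ ω, gaussianIsometry b h₁ ω * gaussianIsometry b h₂ ω
      ∂(Measure.infinitePi fun _ : ι => gaussianReal 0 1) = inner ℝ h₁ h₂ := by
  rw [← (gaussianIsometry b).inner_map_map, L2.inner_def]
  simp [mul_comm]

/-- A finite combination of basis vectors goes to a finite sum of independent Gaussians; the
isometry property supplies the variance. -/
theorem map_gaussianIsometry_of_mem_span {ι H : Type*} [NormedAddCommGroup H]
    [InnerProductSpace ℝ H] (b : HilbertBasis ι ℝ H) {h : H}
    (hh : h ∈ Submodule.span ℝ (Set.range b)) :
    (Measure.infinitePi fun _ : ι => gaussianReal 0 1).map (gaussianIsometry b h)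
      = gaussianReal 0 (‖h‖ ^ 2).toNNReal := by
  obtain ⟨c, rfl⟩ := Finsupp.mem_span_range_iff_exists_finsupp.1 hh
  set μ := Measure.infinitePi fun _ : ι => gaussianReal 0 1
  set x : H := c.sum fun i a => a • b i with hx
  have hsum : gaussianIsometry b x =ᵐ[μ] fun ω => ∑ i : c.support, c i * ω i := by
    have h1 : gaussianIsometry b x = ∑ i ∈ c.support, c i • gaussianCoord i := by
      simp [hx, Finsupp.sum, map_sum, gaussianIsometry_basis]
    rw [h1]
    have h2 : ∀ᵐ ω ∂μ, ∀ i : c.support, (c i • gaussianCoord (i : ι) : Lp ℝ 2 μ) ω = c i * ω i := by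
      refine ae_all_iff.2 fun i => ?_
      filter_upwards [Lp.coeFn_smul (c i) (gaussianCoord (i : ι)), gaussianCoord_coeFn (i : ι)]
        with ω ha hb
      rw [ha, Pi.smul_apply, hb, smul_eq_mul]
    filter_upwards [h2, Lp.coeFn_finsetSum c.support fun i => c i • gaussianCoord i] with ω ha hb
    rw [hb, Finset.sum_apply, ← Finset.sum_coe_sort]
    exact Finset.sum_congr rfl fun i _ => ha i
  have hg : HasGaussianLaw (fun ω : ι → ℝ => ∑ i : c.support, c i * ω i) μ := by
    refine iIndepFun.hasGaussianLaw_fun_sum (X := fun (i : c.support) (ω : ι → ℝ) => c i * ω i)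
      (fun i => ?_) ?_
    · exact (hasLaw_eval_infinitePi_gaussianReal (i : ι)).hasGaussianLaw.fun_smul (c i)
    · exact ((iIndepFun_eval_infinitePi_gaussianReal ι).precomp
        (g := ((↑) : c.support → ι)) Subtype.val_injective).comp (fun i y => c i * y)
        (fun i => by fun_prop)
  have hg' : HasGaussianLaw (gaussianIsometry b x) μ := hg.congr hsum.symm
  have h0 : ∫ ω, gaussianIsometry b x ω ∂μ = 0 := by
    rw [integral_congr_ae hsum, integral_finsetSum]
    · refine Finset.sum_eq_zero fun i _ => ?_
      rw [integral_const_mul, integral_eval_infinitePi_gaussianReal, mul_zero]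
    · exact fun i _ =>
        ((hasLaw_eval_infinitePi_gaussianReal (i : ι)).hasGaussianLaw.integrable).const_mul _
  have hv : Var[gaussianIsometry b x; μ] = ‖x‖ ^ 2 := by
    rw [variance_of_integral_eq_zero hg'.aemeasurable h0, ← real_inner_self_eq_norm_sq,
      ← integral_mul_gaussianIsometry b]
    simp [pow_two, μ]
  rw [hg'.map_eq_gaussianReal, h0, hv]

/-- The span of the basis is dense, `L²` convergence implies convergence in law, and the Gaussian
characteristic function depends continuously on `‖h‖`. -/
theorem map_gaussianIsometry {ι H : Type*} [NormedAddCommGroup H]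
    [InnerProductSpace ℝ H] (b : HilbertBasis ι ℝ H) (h : H) :
    (Measure.infinitePi fun _ : ι => gaussianReal 0 1).map (gaussianIsometry b h)
      = gaussianReal 0 (‖h‖ ^ 2).toNNReal := by
  set μ := Measure.infinitePi fun _ : ι => gaussianReal 0 1
  have hd : h ∈ closure (Submodule.span ℝ (Set.range b) : Set H) := by
    rw [← Submodule.topologicalClosure_coe, b.dense_span]
    trivial
  obtain ⟨u, hu, hlim⟩ := mem_closure_iff_seq_limit.1 hd
  have h1 : TendstoInMeasure μ (fun n => gaussianIsometry b (u n)) atTop (gaussianIsometry b h) :=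
    tendstoInMeasure_of_tendsto_Lp (((gaussianIsometry b).continuous.tendsto h).comp hlim)
  have h2 := (h1.tendstoInDistribution fun n => (Lp.aestronglyMeasurable _).aemeasurable).tendsto
  have hm : IsProbabilityMeasure (μ.map (gaussianIsometry b h)) :=
    Measure.isProbabilityMeasure_map (Lp.aestronglyMeasurable _).aemeasurable
  refine Measure.ext_of_charFun (funext fun t => ?_)
  refine tendsto_nhds_unique (ProbabilityMeasure.tendsto_iff_tendsto_charFun.1 h2 t) ?_
  have h3 : ∀ n, μ.map (gaussianIsometry b (u n)) = gaussianReal 0 (‖u n‖ ^ 2).toNNReal :=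
    fun n => map_gaussianIsometry_of_mem_span b (hu n)
  simp only [ProbabilityMeasure.coe_mk, h3, charFun_gaussianReal]
  have h4 : ∀ x : H, (((‖x‖ ^ 2).toNNReal : ℝ) : ℂ) = ((‖x‖ ^ 2 : ℝ) : ℂ) := fun x => by
    rw [Real.coe_toNNReal _ (by positivity)]
  simp only [h4]
  have hc : Continuous fun x : H =>
      Complex.exp (t * (0 : ℝ) * Complex.I - ((‖x‖ ^ 2 : ℝ) : ℂ) * t ^ 2 / 2) := by fun_prop
  exact (hc.tendsto h).comp hlim

/-- By linearity, a functional `L` of finitely many values is a.e. the image of the single vector `∑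
L(e_i) h_i`, whose law is already known to be Gaussian. -/
theorem isGaussianProcess_gaussianIsometry {ι H : Type*} [NormedAddCommGroup H]
    [InnerProductSpace ℝ H] (b : HilbertBasis ι ℝ H) (S : Set H) :
    IsGaussianProcess (fun (h : S) => (gaussianIsometry b h : (ι → ℝ) → ℝ))
      (Measure.infinitePi fun _ : ι => gaussianReal 0 1) := by
  set μ := Measure.infinitePi fun _ : ι => gaussianReal 0 1
  have hae : ∀ h : H, AEMeasurable (gaussianIsometry b h) μ :=
    fun h => (Lp.aestronglyMeasurable _).aemeasurable
  refine ⟨fun I => ⟨isGaussian_of_map_eq_gaussianReal fun L => ?_⟩⟩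
  classical
  have hm : AEMeasurable (fun ω => I.restrict fun h : S => gaussianIsometry b h ω) μ :=
    aemeasurable_pi_iff.2 fun i => hae _
  rw [AEMeasurable.map_map_of_aemeasurable (by fun_prop) hm]
  set x : H := ∑ i : I, L (Pi.single i 1) • ((i : S) : H) with hx
  refine ⟨0, (‖x‖ ^ 2).toNNReal, ?_⟩
  rw [← map_gaussianIsometry b x]
  refine Measure.map_congr ?_
  have h1 : gaussianIsometry b x = ∑ i : I, L (Pi.single i 1) • gaussianIsometry b ((i : S) : H) := by
    simp [hx, map_sum]
  rw [h1]
  have h2 : ∀ᵐ ω ∂μ, ∀ i : I, (L (Pi.single i 1) • gaussianIsometry b ((i : S) : H) : Lp ℝ 2 μ) ω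
      = L (Pi.single i 1) * gaussianIsometry b ((i : S) : H) ω := by
    refine ae_all_iff.2 fun i => ?_
    filter_upwards [Lp.coeFn_smul (L (Pi.single i 1)) (gaussianIsometry b ((i : S) : H))] with ω ha
    rw [ha, Pi.smul_apply, smul_eq_mul]
  filter_upwards [h2, Lp.coeFn_finsetSum Finset.univ fun i : I =>
    L (Pi.single i 1) • gaussianIsometry b ((i : S) : H)] with ω ha hb
  rw [hb, Finset.sum_apply, Function.comp_apply,
    ← ContinuousLinearMap.coe_coe, LinearMap.pi_apply_eq_sum_univ]
  refine Finset.sum_congr rfl fun i _ => ?_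
  have h3 : (fun j => if i = j then (1 : ℝ) else 0) = Pi.single i 1 := by
    ext j
    simp [Pi.single_apply, eq_comm]
  rw [h3]
  exact (mul_comm _ _).trans (ha i).symm

/-- Every subset of a Hilbert space is the index set of an isonormal process. -/
theorem exists_isIsonormalOn {H : Type w} [NormedAddCommGroup H] [InnerProductSpace ℝ H]
    [CompleteSpace H] (S : Set H) :
    ∃ (Ω : Type w) (_ : MeasurableSpace Ω) (P : Measure Ω) (_ : IsProbabilityMeasure P)
      (Z : S → Ω → ℝ), IsIsonormalOn S Z P := by
  -- The basis is indexed by a subset of `H`, which keeps the sample space `ι → ℝ` in the universe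
  -- `w`.
  obtain ⟨ι, b, -⟩ := exists_hilbertBasis ℝ H
  refine ⟨ι → ℝ, inferInstance, Measure.infinitePi fun _ => gaussianReal 0 1, inferInstance,
    fun h => gaussianIsometry b h, isGaussianProcess_gaussianIsometry b S, fun h => ?_,
    fun h₁ h₂ => integral_mul_gaussianIsometry b h₁ h₂⟩
  have h1 : HasLaw (gaussianIsometry b (h : H)) (gaussianReal 0 (‖(h : H)‖ ^ 2).toNNReal)
      (Measure.infinitePi fun _ : ι => gaussianReal 0 1) :=
    ⟨(Lp.aestronglyMeasurable _).aemeasurable, map_gaussianIsometry b h⟩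
  rw [h1.integral_eq]
  exact integral_id_gaussianReal

/-! ### Densities of product measures. -/

theorem pi_withDensity_fintype {ι 𝒳 : Type*} [Fintype ι] [MeasurableSpace 𝒳] (P : Measure 𝒳)
    [IsProbabilityMeasure P] {q : 𝒳 → ℝ≥0∞} (hq : Measurable q)
    [SigmaFinite (P.withDensity q)] :
    (Measure.pi fun _ : ι => P.withDensity q)
      = (Measure.pi fun _ : ι => P).withDensity fun x => ∏ i, q (x i) := by
  refine Measure.pi_eq fun s hs => ?_
  rw [withDensity_apply _ (MeasurableSet.univ_pi hs),
    ← lintegral_indicator (MeasurableSet.univ_pi hs)]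
  have h1 : ∀ x : ι → 𝒳, (Set.univ.pi s).indicator (fun x => ∏ i, q (x i)) x
      = ∏ i, (s i).indicator q (x i) := by
    intro x
    by_cases hx : x ∈ Set.univ.pi s
    · rw [Set.indicator_of_mem hx]
      exact Finset.prod_congr rfl fun i _ => (Set.indicator_of_mem (hx i trivial) q).symm
    · rw [Set.indicator_of_notMem hx]
      obtain ⟨i, hi⟩ : ∃ i, x i ∉ s i := by simpa [Set.mem_pi] using hx
      exact (Finset.prod_eq_zero (Finset.mem_univ i) (Set.indicator_of_notMem hi q)).symm
  have hm : ∀ i, Measurable ((s i).indicator q) := fun i => hq.indicator (hs i)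
  simp_rw [h1]
  have h2 := lintegral_prod_eq_prod_lintegral_of_indepFun Finset.univ
    (fun i (x : ι → 𝒳) => (s i).indicator q (x i))
    (iIndepFun_pi (μ := fun _ : ι => P) (X := fun i x => (s i).indicator q x)
      fun i => (hm i).aemeasurable)
    (fun i => (hm i).comp (measurable_pi_apply i))
  rw [h2]
  refine Finset.prod_congr rfl fun i _ => ?_
  rw [(measurePreserving_eval (fun _ : ι => P) i).lintegral_comp (hm i),
    lintegral_indicator (hs i), withDensity_apply _ (hs i)]

/-- The density of the absolutely continuous part of a product measure is the product of the
densities. -/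
theorem rnDeriv_pi {ι 𝒳 : Type*} [Fintype ι] [MeasurableSpace 𝒳] (P Q : Measure 𝒳)
    [IsProbabilityMeasure P] [IsProbabilityMeasure Q] :
    (Measure.pi fun _ : ι => Q).rnDeriv (Measure.pi fun _ : ι => P)
      =ᵐ[Measure.pi fun _ : ι => P] fun x => ∏ i, Q.rnDeriv P (x i) := by
  -- `N` carries `P` and is null for the singular part, so `Q` restricted to `N` is the absolutely
  -- continuous part. Restricting the product of the `Q` to the power `M` of `N` thus yields the
  -- product density, while `Mᶜ` is null for the product of the `P`; uniqueness of the Lebesgue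
  -- decomposition concludes.
  obtain ⟨N, hN, hSN, hPN⟩ := Q.mutuallySingular_singularPart P
  have hq : Measurable (Q.rnDeriv P) := Q.measurable_rnDeriv P
  have hr : Q.restrict N = P.withDensity (Q.rnDeriv P) := by
    conv_lhs => rw [Q.haveLebesgueDecomposition_add P]
    rw [Measure.restrict_add, Measure.restrict_eq_zero.2 hSN, zero_add]
    refine Measure.restrict_eq_self_of_ae_mem ?_
    exact withDensity_absolutelyContinuous _ _ hPN
  set M : Set (ι → 𝒳) := Set.univ.pi fun _ => N with hM
  have hMm : MeasurableSet M := MeasurableSet.univ_pi fun _ => hN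
  have hMP : (Measure.pi fun _ : ι => P) Mᶜ = 0 := by
    rw [← mem_ae_iff]
    have h : ∀ᵐ x ∂(Measure.pi fun _ : ι => P), ∀ i, x i ∈ N := by
      refine ae_all_iff.2 fun i => ?_
      exact (measurePreserving_eval (fun _ : ι => P) i).quasiMeasurePreserving.ae
        (mem_ae_iff.2 hPN)
    filter_upwards [h] with x hx i _ using hx i
  have hsf : SigmaFinite (P.withDensity (Q.rnDeriv P)) := hr ▸ inferInstance
  have hsum : (Measure.pi fun _ : ι => Q) = (Measure.pi fun _ : ι => Q).restrict Mᶜ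
      + (Measure.pi fun _ : ι => P).withDensity fun x => ∏ i, Q.rnDeriv P (x i) := by
    rw [← pi_withDensity_fintype P hq]
    simp_rw [← hr]
    rw [← Measure.restrict_pi_pi, add_comm]
    exact (Measure.restrict_add_restrict_compl hMm).symm
  refine (Measure.eq_rnDeriv ?_ ?_ hsum).symm
  · exact Finset.measurable_prod _ fun i _ => hq.comp (measurable_pi_apply i)
  · refine ⟨M, hMm, ?_, hMP⟩
    rw [Measure.restrict_apply hMm]
    simp

/-! ### Root density ratio and the Hellinger integral. -/

section
variable {𝒳 : Type*} [MeasurableSpace 𝒳]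

/-- `2 (√(dQ/dP) - 1)`, where `dQ/dP` is the density of the absolutely continuous part. -/
noncomputable def rootScore (P Q : Measure 𝒳) (x : 𝒳) : ℝ := 2 * (√(Q.rnDeriv P x).toReal - 1)

theorem measurable_rootScore (P Q : Measure 𝒳) : Measurable (rootScore P Q) :=
  ((Q.measurable_rnDeriv P).ennreal_toReal.sqrt.sub_const 1).const_mul 2

/-- Where `dP/dμ > 0`, the chain rule for densities makes the integrand times `dP/dμ` equal to four
times the Hellinger integrand. The set `dP/dμ = 0` contributes only to the right side. -/
theorem lintegral_rootScore_le_hellingerIntegral (P Q : Measure 𝒳) [IsProbabilityMeasure P]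
    [IsProbabilityMeasure Q] {t : ℝ} {g : 𝒳 → ℝ} (hg : Measurable g) :
    ∫⁻ x, ENNReal.ofReal ((rootScore P Q x / t - g x) ^ 2) ∂P
      ≤ 4 * hellingerIntegral (P + Q) P Q t g := by
  set μ := P + Q
  have hP : P ≪ μ := Measure.absolutelyContinuous_of_le (Measure.le_add_right le_rfl)
  have hp : Measurable (P.rnDeriv μ) := P.measurable_rnDeriv μ
  have h1 : ∀ᵐ x ∂P, (Q.rnDeriv P x) * P.rnDeriv μ x = Q.rnDeriv μ x :=
    Measure.rnDeriv_mul_rnDeriv' hP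
  have h2 : ∀ᵐ x ∂μ, P.rnDeriv μ x ≠ 0 → (Q.rnDeriv P x) * P.rnDeriv μ x = Q.rnDeriv μ x := by
    rw [← Measure.withDensity_rnDeriv_eq P μ hP] at h1
    rw [ae_withDensity_iff hp] at h1
    simpa only [Measure.withDensity_rnDeriv_eq P μ hP] using h1
  have hm := measurable_rootScore P Q
  have hF : Measurable fun x => ENNReal.ofReal ((rootScore P Q x / t - g x) ^ 2) :=
    (((hm.div_const t).sub hg).pow_const 2).ennreal_ofReal
  calc ∫⁻ x, ENNReal.ofReal ((rootScore P Q x / t - g x) ^ 2) ∂P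
      = ∫⁻ x, P.rnDeriv μ x * ENNReal.ofReal ((rootScore P Q x / t - g x) ^ 2) ∂μ := by
        rw [lintegral_rnDeriv_mul hP hF.aemeasurable]
    _ ≤ ∫⁻ x, 4 * ENNReal.ofReal (((√(Q.rnDeriv μ x).toReal - √(P.rnDeriv μ x).toReal) / t
          - 1 / 2 * g x * √(P.rnDeriv μ x).toReal) ^ 2) ∂μ := by
        refine lintegral_mono_ae ?_
        filter_upwards [h2, P.rnDeriv_ne_top μ] with x hx hx'
        by_cases h0 : P.rnDeriv μ x = 0
        · simp [h0]
        · rw [← hx h0, ENNReal.toReal_mul, Real.sqrt_mul ENNReal.toReal_nonneg]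
          have h4 : (4 : ℝ≥0∞) = ENNReal.ofReal 4 := by norm_num
          rw [← ENNReal.ofReal_toReal hx', h4, ← ENNReal.ofReal_mul ENNReal.toReal_nonneg,
            ← ENNReal.ofReal_mul (by norm_num), ENNReal.ofReal_toReal hx']
          refine ENNReal.ofReal_le_ofReal (le_of_eq ?_)
          have h5 := Real.sq_sqrt (ENNReal.toReal_nonneg (a := P.rnDeriv μ x))
          unfold rootScore
          generalize √(P.rnDeriv μ x).toReal = s at *
          rw [← h5]
          ring
    _ = 4 * hellingerIntegral (P + Q) P Q t g := lintegral_const_mul' _ _ (by norm_num)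

/-- On a `P`-null set carrying the singular part, `dP/dμ` vanishes and the Hellinger integrand
reduces to `t⁻² dQ/dμ`. -/
theorem singularPart_le_hellingerIntegral (P Q : Measure 𝒳) [IsProbabilityMeasure P]
    [IsProbabilityMeasure Q] (t : ℝ) (g : 𝒳 → ℝ) :
    ENNReal.ofReal (t⁻¹ ^ 2) * Q.singularPart P Set.univ
      ≤ hellingerIntegral (P + Q) P Q t g := by
  set μ := P + Q
  have hP : P ≪ μ := Measure.absolutelyContinuous_of_le (Measure.le_add_right le_rfl)
  have hQ : Q ≪ μ := Measure.absolutelyContinuous_of_le (Measure.le_add_left le_rfl)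
  obtain ⟨N, hN, hSN, hPN⟩ := Q.mutuallySingular_singularPart P
  have h1 : Q.singularPart P Set.univ ≤ Q Nᶜ := by
    calc Q.singularPart P Set.univ ≤ Q.singularPart P N + Q.singularPart P Nᶜ := by
          rw [measure_add_measure_compl hN]
      _ = Q.singularPart P Nᶜ := by rw [hSN, zero_add]
      _ ≤ Q Nᶜ := Q.singularPart_le P Nᶜ
  have h2 : ∀ᵐ x ∂μ, x ∈ Nᶜ → P.rnDeriv μ x = 0 := by
    have h3 : ∫⁻ x in Nᶜ, P.rnDeriv μ x ∂μ = 0 := by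
      rw [Measure.setLIntegral_rnDeriv hP, hPN]
    rw [lintegral_eq_zero_iff (P.measurable_rnDeriv μ)] at h3
    exact (ae_restrict_iff' hN.compl).1 h3
  calc ENNReal.ofReal (t⁻¹ ^ 2) * Q.singularPart P Set.univ
      ≤ ENNReal.ofReal (t⁻¹ ^ 2) * Q Nᶜ := by gcongr
    _ = ∫⁻ x in Nᶜ, ENNReal.ofReal (t⁻¹ ^ 2) * Q.rnDeriv μ x ∂μ := by
        rw [lintegral_const_mul _ (Q.measurable_rnDeriv μ), Measure.setLIntegral_rnDeriv hQ]
    _ ≤ ∫⁻ x in Nᶜ, ENNReal.ofReal (((√(Q.rnDeriv μ x).toReal - √(P.rnDeriv μ x).toReal) / t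
          - 1 / 2 * g x * √(P.rnDeriv μ x).toReal) ^ 2) ∂μ := by
        refine setLIntegral_mono_ae' hN.compl ?_
        filter_upwards [h2, Q.rnDeriv_ne_top μ] with x hx hx' hxN
        rw [hx hxN]
        conv_lhs => rw [← ENNReal.ofReal_toReal hx', ← ENNReal.ofReal_mul (by positivity)]
        refine ENNReal.ofReal_le_ofReal (le_of_eq ?_)
        have h5 := Real.sq_sqrt (ENNReal.toReal_nonneg (a := Q.rnDeriv μ x))
        simp only [ENNReal.toReal_zero, Real.sqrt_zero, sub_zero, mul_zero]
        rw [div_pow, h5, inv_pow]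
        field_simp
    _ ≤ hellingerIntegral (P + Q) P Q t g := setLIntegral_le_lintegral _ _

theorem memLp_sqrt_rnDeriv (P Q : Measure 𝒳) [IsProbabilityMeasure P]
    [IsProbabilityMeasure Q] : MemLp (fun x => √(Q.rnDeriv P x).toReal) 2 P := by
  rw [memLp_two_iff_integrable_sq
    (Q.measurable_rnDeriv P).ennreal_toReal.sqrt.aestronglyMeasurable]
  simp_rw [Real.sq_sqrt ENNReal.toReal_nonneg]
  exact Measure.integrable_toReal_rnDeriv

theorem memLp_rootScore (P Q : Measure 𝒳) [IsProbabilityMeasure P] [IsProbabilityMeasure Q] :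
    MemLp (rootScore P Q) 2 P :=
  ((memLp_sqrt_rnDeriv P Q).sub (memLp_const 1)).const_mul 2

/-- The mean of `rootScore` in terms of its second moment and the mass of the singular part. -/
theorem integral_rootScore (P Q : Measure 𝒳) [IsProbabilityMeasure P] [IsProbabilityMeasure Q] :
    ∫ x, rootScore P Q x ∂P
      = -(Q.singularPart P).real Set.univ - 1 / 4 * ∫ x, rootScore P Q x ^ 2 ∂P := by
  have h1 : Integrable (fun x => √(Q.rnDeriv P x).toReal) P :=
    (memLp_sqrt_rnDeriv P Q).integrable (by norm_num)
  have h2 : Integrable (fun x => (Q.rnDeriv P x).toReal) P := Measure.integrable_toReal_rnDeriv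
  have h3 : ∫ x, (Q.rnDeriv P x).toReal ∂P = 1 - (Q.singularPart P).real Set.univ := by
    have h := Measure.integral_toReal_rnDeriv' (μ := Q) (ν := P)
    simpa using h
  have h4 : ∀ x, rootScore P Q x ^ 2
      = 4 * (Q.rnDeriv P x).toReal - 8 * √(Q.rnDeriv P x).toReal + 4 := by
    intro x
    have h5 := Real.sq_sqrt (ENNReal.toReal_nonneg (a := Q.rnDeriv P x))
    unfold rootScore
    linear_combination 4 * h5
  have h6 : Integrable (fun x => 4 * (Q.rnDeriv P x).toReal - 8 * √(Q.rnDeriv P x).toReal) P :=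
    (h2.const_mul 4).sub (h1.const_mul 8)
  simp_rw [h4]
  rw [integral_add h6 (integrable_const _),
    integral_sub (h2.const_mul 4) (h1.const_mul 8), integral_const_mul, integral_const_mul, h3]
  unfold rootScore
  rw [integral_const_mul, integral_sub h1 (integrable_const _)]
  simp
  ring
end

/-! ### Convergence in probability and the logarithmic expansion. -/

section

theorem integral_abs_mul_abs_le {Ω : Type*} [MeasurableSpace Ω] {μ : Measure Ω} {f g : Ω → ℝ}
    (hf : MemLp f 2 μ) (hg : MemLp g 2 μ) :
    ∫ ω, |f ω| * |g ω| ∂μ ≤ √(∫ ω, f ω ^ 2 ∂μ) * √(∫ ω, g ω ^ 2 ∂μ) := by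
  have h := integral_mul_norm_le_Lp_mul_Lq (μ := μ) (f := f) (g := g) Real.HolderConjugate.two_two
    (by simpa using hf) (by simpa using hg)
  simpa [Real.sqrt_eq_rpow] using h

theorem tendstoInMeasure_zero_of_integral_abs {Ω ι : Type*} [MeasurableSpace Ω] {μ : Measure Ω}
    {l : Filter ι} {f : ι → Ω → ℝ} (hf : ∀ n, Integrable (f n) μ)
    (h : Tendsto (fun n => ∫ ω, |f n ω| ∂μ) l (𝓝 0)) : TendstoInMeasure μ f l 0 := by
  refine tendstoInMeasure_of_tendsto_eLpNorm one_ne_zero (fun n => (hf n).aestronglyMeasurable)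
    aestronglyMeasurable_zero ?_
  have h1 : ∀ n, eLpNorm (f n - 0) 1 μ = ENNReal.ofReal (∫ ω, |f n ω| ∂μ) := by
    intro n
    rw [sub_zero, eLpNorm_one_eq_lintegral_enorm, ← ofReal_integral_norm_eq_lintegral_enorm (hf n)]
    rfl
  simp_rw [h1]
  simpa [Function.comp_def] using (ENNReal.continuous_ofReal.tendsto 0).comp h

theorem tendstoInMeasure_zero_of_integral_sq {Ω ι : Type*} [MeasurableSpace Ω] {μ : Measure Ω}
    [IsProbabilityMeasure μ] {l : Filter ι} {f : ι → Ω → ℝ} (hf : ∀ n, MemLp (f n) 2 μ)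
    (h : Tendsto (fun n => ∫ ω, f n ω ^ 2 ∂μ) l (𝓝 0)) : TendstoInMeasure μ f l 0 := by
  refine tendstoInMeasure_zero_of_integral_abs (fun n => (hf n).integrable (by norm_num)) ?_
  have h1 : Tendsto (fun n => √(∫ ω, f n ω ^ 2 ∂μ)) l (𝓝 0) := by
    simpa [Function.comp_def] using (Real.continuous_sqrt.tendsto 0).comp h
  refine squeeze_zero (fun n => integral_nonneg fun ω => abs_nonneg _) (fun n => ?_) h1
  have h2 := integral_abs_mul_abs_le (hf n) (memLp_const (1 : ℝ))
  simpa using h2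

theorem tendstoInMeasure_zero_iff_abs {Ω ι : Type*} [MeasurableSpace Ω] {μ : Measure Ω}
    {l : Filter ι} {f : ι → Ω → ℝ} :
    TendstoInMeasure μ f l 0
      ↔ ∀ ε, 0 < ε → Tendsto (fun i => μ {ω | ε ≤ |f i ω|}) l (𝓝 0) := by
  rw [tendstoInMeasure_iff_norm]
  simp

theorem TendstoInMeasure.add_zero_real {Ω ι : Type*} [MeasurableSpace Ω] {μ : Measure Ω}
    {l : Filter ι} {f g : ι → Ω → ℝ} (hf : TendstoInMeasure μ f l 0)
    (hg : TendstoInMeasure μ g l 0) : TendstoInMeasure μ (fun n ω => f n ω + g n ω) l 0 := by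
  rw [tendstoInMeasure_zero_iff_abs] at *
  intro ε hε
  have h := (hf (ε / 2) (half_pos hε)).add (hg (ε / 2) (half_pos hε))
  rw [add_zero] at h
  refine tendsto_of_tendsto_of_tendsto_of_le_of_le tendsto_const_nhds h (fun _ => zero_le)
    fun n => (measure_mono fun ω hω => ?_).trans (measure_union_le _ _)
  simp only [Set.mem_ofPred_eq, Set.mem_union] at hω ⊢
  by_contra! hc
  have := abs_add_le (f n ω) (g n ω)
  linarith [hc.1, hc.2]

theorem TendstoInMeasure.const_mul_zero_real {Ω ι : Type*} [MeasurableSpace Ω] {μ : Measure Ω}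
    {l : Filter ι} {f : ι → Ω → ℝ} (hf : TendstoInMeasure μ f l 0) (c : ℝ) :
    TendstoInMeasure μ (fun n ω => c * f n ω) l 0 := by
  rw [tendstoInMeasure_zero_iff_abs] at *
  intro ε hε
  refine tendsto_of_tendsto_of_tendsto_of_le_of_le tendsto_const_nhds
    (hf (ε / (|c| + 1)) (by positivity)) (fun _ => zero_le)
    fun n => measure_mono fun ω hω => ?_
  simp only [Set.mem_ofPred_eq, abs_mul] at hω ⊢
  rw [div_le_iff₀ (by positivity)]
  nlinarith [abs_nonneg (f n ω)]

/-- Second-order Taylor expansion of `2 log(1 - u)` at `u = -w/2`: since `|u| ≤ 1/2`, the remainder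
`|u|³/(1 - |u|)` is at most `2|u|³ = |w|³/4`, and the factor `2` gives `1/2`. -/
theorem abs_log_sub_rootScore_le {𝒳 : Type*} [MeasurableSpace 𝒳] {P Q : Measure 𝒳} {x : 𝒳}
    (h : |rootScore P Q x| ≤ 1) :
    |Real.log (Q.rnDeriv P x).toReal - rootScore P Q x + 1 / 4 * rootScore P Q x ^ 2|
      ≤ 1 / 2 * |rootScore P Q x| ^ 3 := by
  set w := rootScore P Q x with hw
  have hs : √(Q.rnDeriv P x).toReal = 1 - (-(w / 2)) := by
    rw [hw]
    unfold rootScore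
    ring
  have hl : Real.log (Q.rnDeriv P x).toReal = 2 * Real.log (1 - (-(w / 2))) := by
    rw [← hs, Real.log_sqrt ENNReal.toReal_nonneg]
    ring
  have hu : |-(w / 2)| ≤ 1 / 2 := by
    rw [abs_neg, abs_div, abs_two]
    linarith
  have h1 := Real.abs_log_sub_add_sum_range_le (x := -(w / 2)) (by linarith) 2
  simp only [Finset.sum_range_succ, Finset.sum_range_zero] at h1
  have h2 : |(-(w / 2))| ^ (2 + 1) / (1 - |(-(w / 2))|) ≤ 1 / 4 * |w| ^ 3 := by
    rw [div_le_iff₀ (by linarith)]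
    have h3 : |(-(w / 2))| = |w| / 2 := by rw [abs_neg, abs_div, abs_two]
    rw [h3] at hu ⊢
    have h4 : 0 ≤ |w| ^ 3 := by positivity
    nlinarith
  have h5 := h1.trans h2
  rw [hl]
  have h6 : 2 * Real.log (1 - (-(w / 2))) - w + 1 / 4 * w ^ 2
      = 2 * (0 + (-(w / 2)) ^ (0 + 1) / ((0 : ℕ) + 1) + (-(w / 2)) ^ (1 + 1) / ((1 : ℕ) + 1)
        + Real.log (1 - (-(w / 2)))) := by
    push_cast
    ring
  rw [h6, abs_mul, abs_two]
  linarith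

/-! ### Sums of i.i.d. variables on the infinite product. -/

variable {𝒳 : Type*} [MeasurableSpace 𝒳]

theorem hasLaw_eval_infinitePi (P : Measure 𝒳) [IsProbabilityMeasure P] (i : ℕ) :
    HasLaw (fun ω : ℕ → 𝒳 => ω i) P (Measure.infinitePi fun _ : ℕ => P) :=
  (measurePreserving_eval_infinitePi (fun _ : ℕ => P) i).hasLaw

theorem integral_eval_infinitePi (P : Measure 𝒳) [IsProbabilityMeasure P] (i : ℕ) {f : 𝒳 → ℝ}
    (hf : AEStronglyMeasurable f P) :
    ∫ ω, f (ω i) ∂(Measure.infinitePi fun _ : ℕ => P) = ∫ x, f x ∂P :=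
  (hasLaw_eval_infinitePi P i).integral_comp hf

theorem memLp_eval_infinitePi (P : Measure 𝒳) [IsProbabilityMeasure P] (i : ℕ) {f : 𝒳 → ℝ}
    {p : ℝ≥0∞} (hf : MemLp f p P) :
    MemLp (fun ω : ℕ → 𝒳 => f (ω i)) p (Measure.infinitePi fun _ : ℕ => P) :=
  hf.comp_measurePreserving (measurePreserving_eval_infinitePi (fun _ : ℕ => P) i)

theorem iIndepFun_eval_infinitePi (P : Measure 𝒳) [IsProbabilityMeasure P] {f : 𝒳 → ℝ}
    (hf : Measurable f) :
    iIndepFun (fun (i : ℕ) (ω : ℕ → 𝒳) => f (ω i)) (Measure.infinitePi fun _ : ℕ => P) :=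
  iIndepFun_infinitePi (P := fun _ : ℕ => P) (X := fun _ => f) fun _ => hf

theorem identDistrib_eval_infinitePi (P : Measure 𝒳) [IsProbabilityMeasure P] {f : 𝒳 → ℝ}
    (hf : Measurable f) (i : ℕ) :
    IdentDistrib (fun ω : ℕ → 𝒳 => f (ω i)) (fun ω : ℕ → 𝒳 => f (ω 0))
      (Measure.infinitePi fun _ : ℕ => P) (Measure.infinitePi fun _ : ℕ => P) :=
  ((hasLaw_eval_infinitePi P i).identDistrib (hasLaw_eval_infinitePi P 0)).comp hf

theorem integral_sum_eval_infinitePi (P : Measure 𝒳) [IsProbabilityMeasure P] (n : ℕ) {f : 𝒳 → ℝ}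
    (hf : Integrable f P) :
    ∫ ω, ∑ i ∈ Finset.range n, f (ω i) ∂(Measure.infinitePi fun _ : ℕ => P)
      = n * ∫ x, f x ∂P := by
  rw [integral_finsetSum _ fun i _ => memLp_one_iff_integrable.1
    (memLp_eval_infinitePi P i (memLp_one_iff_integrable.2 hf))]
  simp_rw [integral_eval_infinitePi P _ hf.aestronglyMeasurable]
  simp

theorem variance_sum_eval_infinitePi (P : Measure 𝒳) [IsProbabilityMeasure P] (n : ℕ) {f : 𝒳 → ℝ}
    (hfm : Measurable f) (hf : MemLp f 2 P) :
    Var[fun ω => ∑ i ∈ Finset.range n, f (ω i); Measure.infinitePi fun _ : ℕ => P]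
      = n * Var[f; P] := by
  have h := IndepFun.variance_sum (μ := Measure.infinitePi fun _ : ℕ => P)
    (X := fun (i : ℕ) (ω : ℕ → 𝒳) => f (ω i)) (s := Finset.range n)
    (fun i _ => memLp_eval_infinitePi P i hf)
    (fun i _ j _ hij => (iIndepFun_eval_infinitePi P hfm).indepFun hij)
  have h1 : ∀ i, Var[fun ω => f (ω i); Measure.infinitePi fun _ : ℕ => P] = Var[f; P] := by
    exact fun i => (measurePreserving_eval_infinitePi (fun _ : ℕ => P) i).variance_fun_comp
      hfm.aemeasurable
  simp only [h1, Finset.sum_const, Finset.card_range, nsmul_eq_mul] at h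
  rw [← h]
  congr 1
  ext ω
  simp
end

/-! ### Local asymptotic normality in probability. -/

section
variable {𝒳 : Type*} [MeasurableSpace 𝒳]

/-- The difference between the rescaled `rootScore` and the score `g`. -/
noncomputable def scoreRemainder (P : Measure 𝒳) (Q : ℕ → Measure 𝒳) (g : 𝒳 → ℝ) (n : ℕ) (x : 𝒳) :
    ℝ := √n * rootScore P (Q n) x - g x

theorem measurable_scoreRemainder {P : Measure 𝒳} {Q : ℕ → Measure 𝒳}
    {g : 𝒳 → ℝ} (hg : Measurable g) (n : ℕ) :
    Measurable (scoreRemainder P Q g n) :=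
  ((measurable_rootScore P (Q n)).const_mul _).sub hg

variable {P : Measure 𝒳} [IsProbabilityMeasure P] {Q : ℕ → Measure 𝒳}
  [∀ n, IsProbabilityMeasure (Q n)] {g : 𝒳 → ℝ}

theorem memLp_scoreRemainder (hg2 : MemLp g 2 P) (n : ℕ) :
    MemLp (scoreRemainder P Q g n) 2 P :=
  ((memLp_rootScore P (Q n)).const_mul _).sub hg2

theorem tendsto_integral_sq_scoreRemainder (hg : Measurable g)
    (hH : Tendsto (fun n : ℕ => hellingerIntegral (P + Q n) P (Q n) (√n)⁻¹ g) atTop (𝓝 0)) :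
    Tendsto (fun n => ∫ x, scoreRemainder P Q g n x ^ 2 ∂P) atTop (𝓝 0) := by
  have h1 : Tendsto (fun n => ∫⁻ x, ENNReal.ofReal (scoreRemainder P Q g n x ^ 2) ∂P)
      atTop (𝓝 0) := by
    have h4 : Tendsto (fun n : ℕ => 4 * hellingerIntegral (P + Q n) P (Q n) (√n)⁻¹ g)
        atTop (𝓝 0) := by
      simpa using ENNReal.Tendsto.const_mul hH (Or.inr (by norm_num : (4 : ℝ≥0∞) ≠ ⊤))
    refine tendsto_of_tendsto_of_tendsto_of_le_of_le tendsto_const_nhds h4 (fun _ => zero_le)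
      fun n => ?_
    have h5 := lintegral_rootScore_le_hellingerIntegral P (Q n) (t := (√n)⁻¹) hg
    refine le_trans (le_of_eq ?_) h5
    refine lintegral_congr fun x => ?_
    rw [scoreRemainder, div_inv_eq_mul, mul_comm]
  have h2 : ∀ n, ∫ x, scoreRemainder P Q g n x ^ 2 ∂P
      = (∫⁻ x, ENNReal.ofReal (scoreRemainder P Q g n x ^ 2) ∂P).toReal := fun n =>
    integral_eq_lintegral_of_nonneg_ae (ae_of_all _ fun x => sq_nonneg _)
      ((measurable_scoreRemainder hg n).pow_const 2).aestronglyMeasurable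
  simp_rw [h2]
  simpa [Function.comp_def] using (ENNReal.tendsto_toReal ENNReal.zero_ne_top).comp h1

theorem tendsto_natCast_mul_singularPart
    (hH : Tendsto (fun n : ℕ => hellingerIntegral (P + Q n) P (Q n) (√n)⁻¹ g) atTop (𝓝 0)) :
    Tendsto (fun n : ℕ => n * ((Q n).singularPart P).real Set.univ) atTop (𝓝 0) := by
  have h1 : Tendsto (fun n : ℕ => ENNReal.ofReal n * (Q n).singularPart P Set.univ)
      atTop (𝓝 0) := by
    refine tendsto_of_tendsto_of_tendsto_of_le_of_le tendsto_const_nhds hH (fun _ => zero_le)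
      fun n => ?_
    have h5 := singularPart_le_hellingerIntegral P (Q n) (√n)⁻¹ g
    rwa [inv_inv, Real.sq_sqrt (Nat.cast_nonneg n)] at h5
  have h2 := (ENNReal.tendsto_toReal ENNReal.zero_ne_top).comp h1
  refine Tendsto.congr (fun n => ?_) h2
  simp [ENNReal.toReal_mul, Measure.real]

/-- With `D = √n W - g` one has `n W² - g² = D² + 2 D g`, and Cauchy–Schwarz bounds the cross term.
-/
theorem tendsto_integral_abs_sq_rootScore_sub (hg2 : MemLp g 2 P)
    (hD : Tendsto (fun n => ∫ x, scoreRemainder P Q g n x ^ 2 ∂P) atTop (𝓝 0)) :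
    Tendsto (fun n : ℕ => ∫ x, |n * rootScore P (Q n) x ^ 2 - g x ^ 2| ∂P) atTop (𝓝 0) := by
  have h1 : Tendsto (fun n => ∫ x, scoreRemainder P Q g n x ^ 2 ∂P
      + 2 * (√(∫ x, scoreRemainder P Q g n x ^ 2 ∂P) * √(∫ x, g x ^ 2 ∂P))) atTop (𝓝 0) := by
    have hs : Tendsto (fun n => √(∫ x, scoreRemainder P Q g n x ^ 2 ∂P)) atTop (𝓝 0) := by
      simpa [Function.comp_def] using (Real.continuous_sqrt.tendsto 0).comp hD
    simpa using hD.add ((hs.mul_const (√(∫ x, g x ^ 2 ∂P))).const_mul 2)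
  refine squeeze_zero (fun n => integral_nonneg fun x => abs_nonneg _) (fun n => ?_) h1
  have hDn := memLp_scoreRemainder (P := P) (Q := Q) hg2 n
  have hi : Integrable (fun x => |scoreRemainder P Q g n x| * |g x|) P :=
    (hDn.abs).integrable_mul hg2.abs
  have h2 := integral_abs_mul_abs_le hDn hg2
  calc ∫ x, |n * rootScore P (Q n) x ^ 2 - g x ^ 2| ∂P
      ≤ ∫ x, (scoreRemainder P Q g n x ^ 2 + 2 * (|scoreRemainder P Q g n x| * |g x|)) ∂P := by
        refine integral_mono (((memLp_rootScore P (Q n)).integrable_sq.const_mul _).sub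
          hg2.integrable_sq).abs (hDn.integrable_sq.add (hi.const_mul 2)) fun x => ?_
        have hn : (√(n : ℝ)) ^ 2 = n := Real.sq_sqrt (Nat.cast_nonneg n)
        have h3 : n * rootScore P (Q n) x ^ 2 - g x ^ 2
            = scoreRemainder P Q g n x ^ 2 + 2 * (scoreRemainder P Q g n x * g x) := by
          unfold scoreRemainder
          linear_combination -(rootScore P (Q n) x ^ 2) * hn
        simp only [h3]
        refine (abs_add_le _ _).trans (le_of_eq ?_)
        rw [abs_of_nonneg (sq_nonneg _), abs_mul, abs_two, abs_mul]
    _ = ∫ x, scoreRemainder P Q g n x ^ 2 ∂P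
          + 2 * ∫ x, |scoreRemainder P Q g n x| * |g x| ∂P := by
        rw [integral_add hDn.integrable_sq (hi.const_mul 2), integral_const_mul]
    _ ≤ _ := by linarith

theorem tendsto_natCast_mul_integral_rootScore_sq (hg2 : MemLp g 2 P)
    (hD : Tendsto (fun n => ∫ x, scoreRemainder P Q g n x ^ 2 ∂P) atTop (𝓝 0)) :
    Tendsto (fun n : ℕ => n * ∫ x, rootScore P (Q n) x ^ 2 ∂P) atTop (𝓝 (∫ x, g x ^ 2 ∂P)) := by
  rw [tendsto_iff_norm_sub_tendsto_zero]
  refine squeeze_zero (fun n => norm_nonneg _) (fun n => ?_)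
    (tendsto_integral_abs_sq_rootScore_sub hg2 hD)
  rw [← integral_const_mul, ← integral_sub ((memLp_rootScore P (Q n)).integrable_sq.const_mul _)
    hg2.integrable_sq]
  exact norm_integral_le_integral_norm _

theorem tendsto_natCast_mul_integral_rootScore (hg2 : MemLp g 2 P)
    (hD : Tendsto (fun n => ∫ x, scoreRemainder P Q g n x ^ 2 ∂P) atTop (𝓝 0))
    (hS : Tendsto (fun n : ℕ => n * ((Q n).singularPart P).real Set.univ) atTop (𝓝 0)) :
    Tendsto (fun n : ℕ => n * ∫ x, rootScore P (Q n) x ∂P) atTop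
      (𝓝 (-(1 / 4 * ∫ x, g x ^ 2 ∂P))) := by
  have h := hS.neg.sub ((tendsto_natCast_mul_integral_rootScore_sq hg2 hD).const_mul (1 / 4))
  rw [neg_zero, zero_sub] at h
  refine h.congr fun n => ?_
  rw [integral_rootScore]
  ring

/-- Chebyshev for `W` alone only bounds `n P(|W| > ε)`. If `|W| > ε`, then `|g|` or `|√n W - g|` is
at least `ε√n/2`; the first case is handled by the vanishing tail of `∫ g²`, the second by the `L²`
convergence. -/
theorem tendsto_natCast_mul_measure_rootScore_gt (hg : Measurable g) (hg2 : MemLp g 2 P)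
    (hD : Tendsto (fun n => ∫ x, scoreRemainder P Q g n x ^ 2 ∂P) atTop (𝓝 0))
    {ε : ℝ} (hε : 0 < ε) :
    Tendsto (fun n : ℕ => n * P.real {x | ε < |rootScore P (Q n) x|}) atTop (𝓝 0) := by
  have hgi := hg2.integrable_sq
  set B : ℕ → Set 𝒳 := fun n => {x | ε * √n / 2 ≤ |g x|} with hB
  have hBm : ∀ n, MeasurableSet (B n) := fun n => measurableSet_le measurable_const hg.abs
  have h1 : Tendsto (fun n => ∫ x, (B n).indicator (fun x => g x ^ 2) x ∂P) atTop (𝓝 0) := by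
    have h := tendsto_integral_of_dominated_convergence (μ := P)
      (F := fun n => (B n).indicator fun x => g x ^ 2) (f := fun _ => (0 : ℝ))
      (fun x => g x ^ 2)
      (fun n => (hgi.indicator (hBm n)).aestronglyMeasurable) hgi
      (fun n => ae_of_all _ fun x => by
        refine (norm_indicator_le_norm_self _ _).trans (le_of_eq ?_)
        exact abs_of_nonneg (sq_nonneg _))
      (ae_of_all _ fun x => by
        refine tendsto_const_nhds.congr' ?_
        have ht : Tendsto (fun n : ℕ => ε * √(n : ℝ) / 2) atTop atTop :=
          ((Real.tendsto_sqrt_atTop.comp tendsto_natCast_atTop_atTop).const_mul_atTop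
            hε).atTop_div_const two_pos
        filter_upwards [ht.eventually_gt_atTop |g x|] with n hn
        have hx : x ∉ B n := fun hx => absurd hn (not_lt.2 hx)
        exact (Set.indicator_of_notMem hx fun x => g x ^ 2).symm)
    simpa using h
  have h2 : Tendsto (fun n => (ε ^ 2)⁻¹ * (4 * ∫ x, scoreRemainder P Q g n x ^ 2 ∂P
      + 4 * ∫ x, (B n).indicator (fun x => g x ^ 2) x ∂P)) atTop (𝓝 0) := by
    simpa using ((hD.const_mul 4).add (h1.const_mul 4)).const_mul (ε ^ 2)⁻¹
  refine squeeze_zero (fun n => by positivity) (fun n => ?_) h2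
  have hDn := (memLp_scoreRemainder (P := P) (Q := Q) hg2 n).integrable_sq
  set A := {x | ε < |rootScore P (Q n) x|} with hA
  have hAm : MeasurableSet A := measurableSet_lt measurable_const (measurable_rootScore P (Q n)).abs
  have h3 : ε ^ 2 * (n * P.real A) ≤ 4 * ∫ x, scoreRemainder P Q g n x ^ 2 ∂P
      + 4 * ∫ x, (B n).indicator (fun x => g x ^ 2) x ∂P := by
    rw [← integral_const_mul, ← integral_const_mul, ← integral_add (hDn.const_mul 4)
      ((hgi.indicator (hBm n)).const_mul 4)]
    have h4 : ε ^ 2 * (n * P.real A) = ∫ x, A.indicator (fun _ => ε ^ 2 * n) x ∂P := by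
      rw [integral_indicator hAm]
      simp
      ring
    rw [h4]
    refine integral_mono ((integrable_const _).indicator hAm)
      ((hDn.const_mul 4).add ((hgi.indicator (hBm n)).const_mul 4)) fun x => ?_
    have hnn : 0 ≤ (B n).indicator (fun x => g x ^ 2) x :=
      Set.indicator_nonneg (fun _ _ => sq_nonneg _) _
    have hsn : 0 ≤ √(n : ℝ) := Real.sqrt_nonneg _
    have hn : (√(n : ℝ)) ^ 2 = n := Real.sq_sqrt (Nat.cast_nonneg n)
    by_cases hx : x ∈ A
    · simp only [Set.indicator_of_mem hx]
      have hx' : ε < |rootScore P (Q n) x| := hx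
      by_cases hxB : x ∈ B n
      · rw [Set.indicator_of_mem hxB]
        have hxB' : ε * √n / 2 ≤ |g x| := hxB
        have h5 : (ε * √n / 2) ^ 2 ≤ |g x| ^ 2 := by gcongr
        rw [sq_abs, div_pow, mul_pow, hn] at h5
        nlinarith [sq_nonneg (scoreRemainder P Q g n x)]
      · have hxB' : |g x| < ε * √n / 2 := not_le.1 hxB
        have h6 : ε * √n / 2 ≤ |scoreRemainder P Q g n x| := by
          have h7 : √n * |rootScore P (Q n) x| - |g x| ≤ |scoreRemainder P Q g n x| := by
            have h8 := abs_sub_abs_le_abs_sub (√n * rootScore P (Q n) x) (g x)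
            rwa [abs_mul, abs_of_nonneg hsn] at h8
          nlinarith
        have h5 : (ε * √n / 2) ^ 2 ≤ |scoreRemainder P Q g n x| ^ 2 := by gcongr
        rw [sq_abs, div_pow, mul_pow, hn] at h5
        linarith
    · simp only [Set.indicator_of_notMem hx]
      have := sq_nonneg (scoreRemainder P Q g n x)
      linarith
  rw [← div_eq_inv_mul, le_div_iff₀ (by positivity)]
  linarith

/-- The variable is `n^{-1/2} ∑ D_i + ‖g‖²/4` with `D = √n W - g`. By independence its variance is
at most `∫ D²`; as `∫ g = 0`, its mean is `n ∫ W + ‖g‖²/4`. Both tend to `0`. -/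
theorem tendstoInMeasure_sum_rootScore (hg : Measurable g) (hg2 : MemLp g 2 P)
    (hg0 : ∫ x, g x ∂P = 0)
    (hD : Tendsto (fun n => ∫ x, scoreRemainder P Q g n x ^ 2 ∂P) atTop (𝓝 0))
    (hS : Tendsto (fun n : ℕ => n * ((Q n).singularPart P).real Set.univ) atTop (𝓝 0)) :
    TendstoInMeasure (Measure.infinitePi fun _ : ℕ => P)
      (fun (n : ℕ) ω => ∑ i ∈ Finset.range n, rootScore P (Q n) (ω i)
        - (√n)⁻¹ * ∑ i ∈ Finset.range n, g (ω i) + 1 / 4 * ∫ x, g x ^ 2 ∂P) atTop 0 := by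
  set μ := Measure.infinitePi fun _ : ℕ => P
  set c := 1 / 4 * ∫ x, g x ^ 2 ∂P with hc
  set V : ℕ → (ℕ → 𝒳) → ℝ := fun n ω =>
    (√n)⁻¹ * ∑ i ∈ Finset.range n, scoreRemainder P Q g n (ω i) + c with hV
  have hVeq : (fun (n : ℕ) ω => ∑ i ∈ Finset.range n, rootScore P (Q n) (ω i)
      - (√n)⁻¹ * ∑ i ∈ Finset.range n, g (ω i) + c) = V := by
    ext n ω
    rcases Nat.eq_zero_or_pos n with rfl | hn
    · simp [hV]
    · have h0 : √(n : ℝ) ≠ 0 := by positivity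
      simp only [hV, scoreRemainder, Finset.sum_sub_distrib, ← Finset.mul_sum]
      field_simp
  rw [hVeq]
  have hDm := fun n => memLp_scoreRemainder (P := P) (Q := Q) hg2 n
  have hsum : ∀ n, MemLp (fun ω : ℕ → 𝒳 => ∑ i ∈ Finset.range n, scoreRemainder P Q g n (ω i)) 2 μ :=
    fun n => memLp_finsetSum _ fun i _ => memLp_eval_infinitePi P i (hDm n)
  have hVm : ∀ n, MemLp (V n) 2 μ := fun n => ((hsum n).const_mul _).add (memLp_const c)
  refine tendstoInMeasure_zero_of_integral_sq hVm ?_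
  have hmean : ∀ n, ∫ ω, V n ω ∂μ = n * ∫ x, rootScore P (Q n) x ∂P + c := by
    intro n
    rw [integral_add (((hsum n).integrable (by norm_num)).const_mul _) (integrable_const c),
      integral_const_mul, integral_sum_eval_infinitePi P n ((hDm n).integrable (by norm_num))]
    unfold scoreRemainder
    rw [integral_sub (((memLp_rootScore P (Q n)).integrable (by norm_num)).const_mul _)
      (hg2.integrable (by norm_num)), integral_const_mul, hg0]
    rcases Nat.eq_zero_or_pos n with rfl | hn
    · simp
    · have h0 : √(n : ℝ) ≠ 0 := by positivity
      simp
      field_simp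
  have hvar : ∀ n, Var[V n; μ] ≤ ∫ x, scoreRemainder P Q g n x ^ 2 ∂P := by
    intro n
    have h1 : Var[V n; μ] = ((√n)⁻¹) ^ 2 * (n * Var[scoreRemainder P Q g n; P]) := by
      rw [← variance_sum_eval_infinitePi P n (measurable_scoreRemainder hg n) (hDm n),
        ← variance_const_mul, ← variance_add_const (((hsum n).const_mul _).aestronglyMeasurable) c]
    have h2 : Var[scoreRemainder P Q g n; P] ≤ ∫ x, scoreRemainder P Q g n x ^ 2 ∂P :=
      variance_le_expectation_sq (hDm n).aestronglyMeasurable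
    have h3 : 0 ≤ Var[scoreRemainder P Q g n; P] := variance_nonneg _ _
    rw [h1, inv_pow, Real.sq_sqrt (Nat.cast_nonneg n), ← mul_assoc]
    refine le_trans ?_ h2
    exact mul_le_of_le_one_left h3 inv_mul_le_one
  have hlim : Tendsto (fun n : ℕ => ∫ x, scoreRemainder P Q g n x ^ 2 ∂P
      + (n * ∫ x, rootScore P (Q n) x ∂P + c) ^ 2) atTop (𝓝 0) := by
    have h1 := (tendsto_natCast_mul_integral_rootScore hg2 hD hS).add_const c
    rw [← hc, neg_add_cancel] at h1
    simpa using hD.add (h1.pow 2)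
  refine squeeze_zero (fun n => integral_nonneg fun ω => sq_nonneg _) (fun n => ?_) hlim
  have h1 := variance_eq_sub (hVm n)
  have h2 := hvar n
  rw [h1, hmean] at h2
  simp only [Pi.pow_apply] at h2
  linarith

/-- Replacing `n W²` by `g²` costs an average that vanishes in `L¹`; the average of `g²` then obeys
the strong law. -/
theorem tendstoInMeasure_sum_rootScore_sq (hg : Measurable g) (hg2 : MemLp g 2 P)
    (hD : Tendsto (fun n => ∫ x, scoreRemainder P Q g n x ^ 2 ∂P) atTop (𝓝 0)) :
    TendstoInMeasure (Measure.infinitePi fun _ : ℕ => P)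
      (fun (n : ℕ) ω => ∑ i ∈ Finset.range n, rootScore P (Q n) (ω i) ^ 2
        - ∫ x, g x ^ 2 ∂P) atTop 0 := by
  set μ := Measure.infinitePi fun _ : ℕ => P
  have hgi := hg2.integrable_sq
  have hWi := fun n => (memLp_rootScore P (Q n)).integrable_sq
  have hf : ∀ n : ℕ, Integrable (fun x => n * rootScore P (Q n) x ^ 2 - g x ^ 2) P :=
    fun n => ((hWi n).const_mul _).sub hgi
  have hf' : ∀ (n i : ℕ), Integrable (fun ω : ℕ → 𝒳 =>
      n * rootScore P (Q n) (ω i) ^ 2 - g (ω i) ^ 2) μ := fun n i =>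
    memLp_one_iff_integrable.1 (memLp_eval_infinitePi P i (memLp_one_iff_integrable.2 (hf n)))
  have h1 : TendstoInMeasure μ (fun (n : ℕ) ω => (n : ℝ)⁻¹ * ∑ i ∈ Finset.range n,
      (n * rootScore P (Q n) (ω i) ^ 2 - g (ω i) ^ 2)) atTop 0 := by
    refine tendstoInMeasure_zero_of_integral_abs
      (fun n => (integrable_finsetSum _ fun i _ => hf' n i).const_mul _) ?_
    refine squeeze_zero (fun n => integral_nonneg fun ω => abs_nonneg _) (fun n => ?_)
      (tendsto_integral_abs_sq_rootScore_sub hg2 hD)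
    have h2 := integral_sum_eval_infinitePi P n (hf n).abs
    calc ∫ ω, |(n : ℝ)⁻¹ * ∑ i ∈ Finset.range n,
          (n * rootScore P (Q n) (ω i) ^ 2 - g (ω i) ^ 2)| ∂μ
        ≤ ∫ ω, (n : ℝ)⁻¹ * ∑ i ∈ Finset.range n,
          |n * rootScore P (Q n) (ω i) ^ 2 - g (ω i) ^ 2| ∂μ := by
          refine integral_mono ((integrable_finsetSum _ fun i _ => hf' n i).const_mul _).abs
            ((integrable_finsetSum _ fun i _ => (hf' n i).abs).const_mul _) fun ω => ?_
          simp only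
          rw [abs_mul, abs_of_nonneg (by positivity : (0 : ℝ) ≤ (n : ℝ)⁻¹)]
          gcongr
          exact Finset.abs_sum_le_sum_abs _ _
      _ = (n : ℝ)⁻¹ * (n * ∫ x, |n * rootScore P (Q n) x ^ 2 - g x ^ 2| ∂P) := by
          rw [integral_const_mul, h2]
      _ ≤ ∫ x, |n * rootScore P (Q n) x ^ 2 - g x ^ 2| ∂P := by
          rw [← mul_assoc]
          exact mul_le_of_le_one_left (integral_nonneg fun x => abs_nonneg _) inv_mul_le_one
  have h3 : TendstoInMeasure μ (fun (n : ℕ) ω => (∑ i ∈ Finset.range n, g (ω i) ^ 2) / n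
      - ∫ x, g x ^ 2 ∂P) atTop 0 := by
    have hgm : Measurable fun x => g x ^ 2 := hg.pow_const 2
    have h := strong_law_ae_real (μ := μ) (fun (i : ℕ) (ω : ℕ → 𝒳) => g (ω i) ^ 2)
      (memLp_one_iff_integrable.1 (memLp_eval_infinitePi P 0 (memLp_one_iff_integrable.2 hgi)))
      (fun i j hij => (iIndepFun_eval_infinitePi P hgm).indepFun hij)
      (fun i => identDistrib_eval_infinitePi P hgm i)
    have hi : ∫ ω, g (ω 0) ^ 2 ∂μ = ∫ x, g x ^ 2 ∂P :=
      integral_eval_infinitePi P 0 hgi.aestronglyMeasurable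
    rw [hi] at h
    refine tendstoInMeasure_of_tendsto_ae (fun n => ?_) ?_
    · exact (((Finset.measurable_sum _ fun i _ => hgm.comp (measurable_pi_apply i)).div_const
        _).sub_const _).aestronglyMeasurable
    · filter_upwards [h] with ω hω
      have h4 := hω.sub_const (∫ x, g x ^ 2 ∂P)
      rwa [sub_self] at h4
  refine (TendstoInMeasure.add_zero_real h1 h3).congr' ?_ EventuallyEq.rfl
  filter_upwards [eventually_gt_atTop 0] with n hn
  refine ae_of_all _ fun ω => ?_
  have h0 : (n : ℝ) ≠ 0 := by positivity
  simp only [Finset.sum_sub_distrib, ← Finset.mul_sum]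
  field_simp
  ring

theorem tendsto_measure_exists_rootScore_gt (hg : Measurable g) (hg2 : MemLp g 2 P)
    (hD : Tendsto (fun n => ∫ x, scoreRemainder P Q g n x ^ 2 ∂P) atTop (𝓝 0))
    {ε : ℝ} (hε : 0 < ε) :
    Tendsto (fun n : ℕ => (Measure.infinitePi fun _ : ℕ => P)
      {ω | ∃ i ∈ Finset.range n, ε < |rootScore P (Q n) (ω i)|}) atTop (𝓝 0) := by
  have h1 := (ENNReal.continuous_ofReal.tendsto 0).comp
    (tendsto_natCast_mul_measure_rootScore_gt hg hg2 hD hε)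
  rw [ENNReal.ofReal_zero] at h1
  refine tendsto_of_tendsto_of_tendsto_of_le_of_le tendsto_const_nhds h1 (fun _ => zero_le)
    fun n => ?_
  have hA : MeasurableSet {x | ε < |rootScore P (Q n) x|} :=
    measurableSet_lt measurable_const (measurable_rootScore P (Q n)).abs
  calc (Measure.infinitePi fun _ : ℕ => P) {ω | ∃ i ∈ Finset.range n, ε < |rootScore P (Q n) (ω i)|}
      ≤ ∑ i ∈ Finset.range n, (Measure.infinitePi fun _ : ℕ => P)
          {ω | ε < |rootScore P (Q n) (ω i)|} := by
        refine (measure_mono ?_).trans (measure_biUnion_finset_le _ _)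
        intro ω hω
        simpa using hω
    _ = n * P {x | ε < |rootScore P (Q n) x|} := by
        have h2 : ∀ i : ℕ, (Measure.infinitePi fun _ : ℕ => P) {ω | ε < |rootScore P (Q n) (ω i)|}
            = P {x | ε < |rootScore P (Q n) x|} := fun i =>
          (measurePreserving_eval_infinitePi (fun _ : ℕ => P) i).measure_preimage
            hA.nullMeasurableSet
        simp [h2]
    _ = _ := by
        simp only [Function.comp_apply]
        rw [ENNReal.ofReal_mul (Nat.cast_nonneg n), ENNReal.ofReal_natCast, ofReal_measureReal]

/-- The second-order expansion of the log-likelihood ratio of the product experiment. -/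
theorem tendstoInMeasure_sum_log_rnDeriv_sub (hg : Measurable g) (hg2 : MemLp g 2 P)
    (hD : Tendsto (fun n => ∫ x, scoreRemainder P Q g n x ^ 2 ∂P) atTop (𝓝 0)) :
    TendstoInMeasure (Measure.infinitePi fun _ : ℕ => P)
      (fun (n : ℕ) ω => ∑ i ∈ Finset.range n, (Real.log ((Q n).rnDeriv P (ω i)).toReal
        - rootScore P (Q n) (ω i) + 1 / 4 * rootScore P (Q n) (ω i) ^ 2)) atTop 0 := by
  rw [tendstoInMeasure_zero_iff_abs]
  intro δ hδ
  set s := ∫ x, g x ^ 2 ∂P with hs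
  have hs0 : 0 ≤ s := integral_nonneg fun x => sq_nonneg _
  -- When all `|W_i| ≤ ε` and `∑ W_i² < s + 1`, the cubic remainders sum to at most `(ε/2) ∑ W_i² <
  -- δ`.
  set ε := min 1 (δ / (s + 1)) with hε
  have hε0 : 0 < ε := lt_min one_pos (by positivity)
  have hεδ : ε * (s + 1) ≤ δ := (le_div_iff₀ (by positivity)).1 (min_le_right _ _)
  have h := (tendsto_measure_exists_rootScore_gt hg hg2 hD hε0).add
    (tendstoInMeasure_zero_iff_abs.1 (tendstoInMeasure_sum_rootScore_sq hg hg2 hD) 1 one_pos)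
  rw [add_zero] at h
  refine tendsto_of_tendsto_of_tendsto_of_le_of_le tendsto_const_nhds h (fun _ => zero_le)
    fun n => (measure_mono fun ω hω => ?_).trans (measure_union_le _ _)
  simp only [Set.mem_ofPred_eq, Set.mem_union] at hω ⊢
  by_contra! hc
  obtain ⟨hc1, hc2⟩ := hc
  have h2 : ∑ i ∈ Finset.range n, rootScore P (Q n) (ω i) ^ 2 < s + 1 := by
    have := (abs_lt.1 hc2).2
    linarith
  have h3 : δ ≤ ε / 2 * ∑ i ∈ Finset.range n, rootScore P (Q n) (ω i) ^ 2 := by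
    refine hω.trans ((Finset.abs_sum_le_sum_abs _ _).trans ?_)
    rw [Finset.mul_sum]
    refine Finset.sum_le_sum fun i hi => ?_
    have hi' := hc1 i hi
    refine (abs_log_sub_rootScore_le (hi'.trans (min_le_left _ _))).trans ?_
    rw [← sq_abs (rootScore P (Q n) (ω i))]
    nlinarith [sq_nonneg |rootScore P (Q n) (ω i)|]
  nlinarith

/-- Local asymptotic normality of the product experiments, in probability. -/
theorem tendstoInMeasure_sum_log_rnDeriv (hg : Measurable g) (hg2 : MemLp g 2 P)
    (hg0 : ∫ x, g x ∂P = 0)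
    (hH : Tendsto (fun n : ℕ => hellingerIntegral (P + Q n) P (Q n) (√n)⁻¹ g) atTop (𝓝 0)) :
    TendstoInMeasure (Measure.infinitePi fun _ : ℕ => P)
      (fun (n : ℕ) ω => ∑ i ∈ Finset.range n, Real.log ((Q n).rnDeriv P (ω i)).toReal
        + 1 / 2 * ∫ x, g x ^ 2 ∂P - (√n)⁻¹ * ∑ i ∈ Finset.range n, g (ω i)) atTop 0 := by
  have hD := tendsto_integral_sq_scoreRemainder hg hH
  have hS := tendsto_natCast_mul_singularPart hH
  -- The constant `1/2` is `1/4` from the mean of `∑ W_i` plus `1/4` from the limit of `∑ W_i² / 4`.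
  have h := TendstoInMeasure.add_zero_real
    (TendstoInMeasure.add_zero_real (tendstoInMeasure_sum_log_rnDeriv_sub hg hg2 hD)
      (tendstoInMeasure_sum_rootScore hg hg2 hg0 hD hS))
    (TendstoInMeasure.const_mul_zero_real (tendstoInMeasure_sum_rootScore_sq hg hg2 hD) (-(1 / 4)))
  refine h.congr_left fun n => ae_of_all _ fun ω => ?_
  simp only [Finset.sum_add_distrib, Finset.sum_sub_distrib, ← Finset.mul_sum]
  ring
end

/-! ### Weak convergence and the multivariate central limit theorem. -/

section

/-- A bounded test function `f` changes in mean by at most `2‖f‖ μ(X ≠ Y)`. No subtraction in `F` is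
involved, so this applies to extended-real variables. -/
theorem tendstoInDistribution_of_tendsto_measure_ne {Ω Ω' F ι : Type*} [MeasurableSpace Ω]
    [MeasurableSpace Ω'] [TopologicalSpace F] [MeasurableSpace F] [BorelSpace F]
    {μ : Measure Ω} [IsProbabilityMeasure μ] {μ' : Measure Ω'} [IsProbabilityMeasure μ']
    {l : Filter ι} {X Y : ι → Ω → F} {Z : Ω' → F}
    (hX : TendstoInDistribution X l Z (fun _ => μ) μ') (hY : ∀ n, AEMeasurable (Y n) μ)
    (h : Tendsto (fun n => μ {ω | X n ω ≠ Y n ω}) l (𝓝 0)) :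
    TendstoInDistribution Y l Z (fun _ => μ) μ' := by
  refine ⟨hY, hX.aemeasurable_limit,
    ProbabilityMeasure.tendsto_iff_forall_integral_tendsto.2 fun f => ?_⟩
  have h1 := ProbabilityMeasure.tendsto_iff_forall_integral_tendsto.1 hX.tendsto f
  have hXm := hX.forall_aemeasurable
  have hfm : Measurable f := f.continuous.measurable
  refine (tendsto_of_tendsto_of_dist h1 ?_)
  -- The set `{X ≠ Y}` need not be measurable, hence the measurable hull.
  have h2 : Tendsto (fun n => 2 * ‖f‖ * μ.real (toMeasurable μ {ω | X n ω ≠ Y n ω})) l (𝓝 0) := by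
    have h3 := (ENNReal.tendsto_toReal ENNReal.zero_ne_top).comp h
    simpa [Measure.real, measure_toMeasurable, Function.comp_def] using h3.const_mul (2 * ‖f‖)
  refine squeeze_zero (fun n => dist_nonneg) (fun n => ?_) h2
  simp only [ProbabilityMeasure.coe_mk]
  rw [integral_map (hXm n) hfm.aestronglyMeasurable, integral_map (hY n) hfm.aestronglyMeasurable,
    dist_eq_norm]
  have hi : ∀ {V : Ω → F}, AEMeasurable V μ → Integrable (fun ω => f (V ω)) μ := fun hV =>
    Integrable.of_bound (hfm.comp_aemeasurable hV).aestronglyMeasurable ‖f‖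
      (ae_of_all _ fun ω => f.norm_coe_le_norm _)
  rw [← integral_sub (hi (hXm n)) (hi (hY n))]
  set B := toMeasurable μ {ω | X n ω ≠ Y n ω} with hB
  have hBm : MeasurableSet B := measurableSet_toMeasurable _ _
  calc ‖∫ ω, (f (X n ω) - f (Y n ω)) ∂μ‖
      ≤ ∫ ω, B.indicator (fun _ => 2 * ‖f‖) ω ∂μ := by
        refine norm_integral_le_of_norm_le ((integrable_const _).indicator hBm)
          (ae_of_all _ fun ω => ?_)
        by_cases hω : ω ∈ B
        · rw [Set.indicator_of_mem hω, ← dist_eq_norm]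
          exact f.dist_le_two_norm _ _
        · rw [Set.indicator_of_notMem hω]
          have h4 : X n ω = Y n ω := by
            by_contra hne
            exact hω (subset_toMeasurable μ _ hne)
          rw [h4, sub_self, norm_zero]
    _ = 2 * ‖f‖ * μ.real B := by
        rw [integral_indicator hBm]
        simp [mul_comm]

theorem charFun_map_eq_charFun_map_inner {Ω E : Type*} [MeasurableSpace Ω] [NormedAddCommGroup E]
    [InnerProductSpace ℝ E] [MeasurableSpace E] [BorelSpace E] [SecondCountableTopology E]
    {μ : Measure Ω} {X : Ω → E} (hX : AEMeasurable X μ) (t : E) :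
    charFun (μ.map X) t = charFun (μ.map fun ω => inner ℝ (X ω) t) 1 := by
  have hXt : AEMeasurable (fun ω => inner ℝ (X ω) t) μ := hX.inner_const
  rw [charFun_apply, charFun_apply, integral_map hX (by fun_prop), integral_map hXt (by fun_prop)]
  simp

theorem integral_sq_sum_mul {Ω ι : Type*} [Fintype ι] [MeasurableSpace Ω] {μ : Measure Ω}
    {X : ι → Ω → ℝ} (hX : ∀ i, MemLp (X i) 2 μ) (t : ι → ℝ) :
    ∫ ω, (∑ i, t i * X i ω) ^ 2 ∂μ = ∑ i, ∑ j, t i * t j * ∫ ω, X i ω * X j ω ∂μ := by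
  have hij : ∀ i j, Integrable (fun ω => t i * t j * (X i ω * X j ω)) μ :=
    fun i j => ((hX i).integrable_mul (hX j)).const_mul _
  have h1 : ∀ ω, (∑ i, t i * X i ω) ^ 2 = ∑ i, ∑ j, t i * t j * (X i ω * X j ω) := by
    intro ω
    rw [pow_two, Finset.sum_mul_sum]
    exact Finset.sum_congr rfl fun i _ => Finset.sum_congr rfl fun j _ => by ring
  simp_rw [h1]
  rw [integral_finsetSum _ fun i _ => integrable_finsetSum _ fun j _ => hij i j]
  refine Finset.sum_congr rfl fun i _ => ?_
  rw [integral_finsetSum _ fun j _ => hij i j]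
  exact Finset.sum_congr rfl fun j _ => integral_const_mul _ _

variable {𝒳 : Type*} [MeasurableSpace 𝒳] {P : Measure 𝒳} [IsProbabilityMeasure P]

theorem inner_L20 (f g : L20 P) :
    inner ℝ f g = ∫ x, (f : Lp ℝ 2 P) x * (g : Lp ℝ 2 P) x ∂P := by
  rw [Submodule.coe_inner, L2.inner_def]
  simp [mul_comm]

theorem norm_sq_L20 (f : L20 P) : ‖f‖ ^ 2 = ∫ x, (f : Lp ℝ 2 P) x ^ 2 ∂P := by
  rw [← real_inner_self_eq_norm_sq, inner_L20]
  simp [pow_two]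

theorem measurable_coe_Lp {P : Measure 𝒳} (f : Lp ℝ 2 P) :
    Measurable f := (Lp.stronglyMeasurable f).measurable

/-- The multivariate central limit theorem, with the limit given by an isonormal process. -/
theorem tendstoInDistribution_normalized_sum_L20 {Ω' : Type*} [MeasurableSpace Ω']
    {P' : Measure Ω'} [IsProbabilityMeasure P'] {S : Set (L20 P)} {Z : S → Ω' → ℝ}
    (hZ : IsIsonormalOn S Z P') {k : ℕ} (h : Fin k → S) :
    TendstoInDistribution
      (fun (n : ℕ) (ω : ℕ → 𝒳) (j : Fin k) =>
        (√n)⁻¹ * ∑ i ∈ Finset.range n, ((h j : L20 P) : Lp ℝ 2 P) (ω i))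
      atTop (fun ω' j => Z (h j) ω') (fun _ => Measure.infinitePi fun _ : ℕ => P) P' := by
  set μ := Measure.infinitePi fun _ : ℕ => P
  set f : Fin k → 𝒳 → ℝ := fun j => ((h j : L20 P) : Lp ℝ 2 P) with hf
  have hfm : ∀ j, Measurable (f j) := fun j => measurable_coe_Lp _
  have hf2 : ∀ j, MemLp (f j) 2 P := fun j => Lp.memLp _
  have hf0 : ∀ j, ∫ x, f j x ∂P = 0 := fun j => mem_L20.1 (h j : L20 P).2
  have hG : IsGaussianProcess (fun j => Z (h j)) P' := hZ.isGaussianProcess.comp_right h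
  have hZ2 : ∀ j, MemLp (Z (h j)) 2 P' := fun j => (hG.hasGaussianLaw_eval j).memLp_two
  set Y : ℕ → (ℕ → 𝒳) → EuclideanSpace ℝ (Fin k) := fun n ω =>
    WithLp.toLp 2 fun j => (√n)⁻¹ * ∑ i ∈ Finset.range n, f j (ω i) with hY
  have hYm : ∀ n, AEMeasurable (Y n) μ := fun n =>
    ((WithLp.measurable_toLp 2 _).comp (measurable_pi_iff.2 fun j =>
      (Finset.measurable_sum _ fun i _ => (hfm j).comp (measurable_pi_apply i)).const_mul
        _)).aemeasurable
  have hZm : AEMeasurable (fun ω' => (WithLp.toLp 2 fun j => Z (h j) ω' :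
      EuclideanSpace ℝ (Fin k))) P' :=
    (WithLp.measurable_toLp 2 _).comp_aemeasurable
      (aemeasurable_pi_iff.2 fun j => (hG.hasGaussianLaw_eval j).aemeasurable)
  have hmain : TendstoInDistribution Y atTop
      (fun ω' => (WithLp.toLp 2 fun j => Z (h j) ω' : EuclideanSpace ℝ (Fin k)))
      (fun _ => μ) P' := by
    refine ⟨hYm, hZm, ProbabilityMeasure.tendsto_iff_tendsto_charFun.2 fun t => ?_⟩
    simp only [ProbabilityMeasure.coe_mk]
    -- Cramér–Wold: project on `t` and apply the one-dimensional theorem to `F = ∑ t_j f_j`.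
    rw [charFun_map_eq_charFun_map_inner hZm t]
    simp_rw [charFun_map_eq_charFun_map_inner (hYm _) t]
    set F : 𝒳 → ℝ := fun x => ∑ j, t j * f j x with hF
    have hFm : Measurable F := Finset.measurable_sum _ fun j _ => (hfm j).const_mul _
    have hF2 : MemLp F 2 P := memLp_finsetSum _ fun j _ => (hf2 j).const_mul _
    have hF0 : ∫ x, F x ∂P = 0 := by
      rw [hF, integral_finsetSum _ fun j _ => ((hf2 j).integrable (by norm_num)).const_mul _]
      simp [integral_const_mul, hf0]
    set W : Ω' → ℝ := fun ω' => ∑ j, t j * Z (h j) ω' with hW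
    have hWG : HasGaussianLaw W P' := by
      have := (hG.smul fun j => t j).hasGaussianLaw_fun_sum (I := Finset.univ)
      simpa [hW] using this
    have hW0 : ∫ ω', W ω' ∂P' = 0 := by
      rw [hW, integral_finsetSum _ fun j _ => ((hZ2 j).integrable (by norm_num)).const_mul _]
      simp [integral_const_mul, hZ.centered]
    -- Both variances are the quadratic form `∑ t_i t_j ⟨h_i, h_j⟩`, possibly zero.
    have hvar : Var[W; P'] = Var[fun ω : ℕ → 𝒳 => F (ω 0); μ] := by
      rw [(measurePreserving_eval_infinitePi (fun _ : ℕ => P) 0).variance_fun_comp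
        hFm.aemeasurable, variance_of_integral_eq_zero hWG.aemeasurable hW0,
        variance_of_integral_eq_zero hFm.aemeasurable hF0, integral_sq_sum_mul hZ2,
        integral_sq_sum_mul hf2]
      simp_rw [hZ.covariance, inner_L20, hf]
    have hlaw : HasLaw W (gaussianReal 0 (Var[fun ω : ℕ → 𝒳 => F (ω 0); μ]).toNNReal) P' :=
      ⟨hWG.aemeasurable, by rw [hWG.map_eq_gaussianReal, hW0, hvar]⟩
    have hclt := tendstoInDistribution_inv_sqrt_mul_sum_sub (P := μ)
      (X := fun (i : ℕ) (ω : ℕ → 𝒳) => F (ω i)) hlaw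
      (memLp_eval_infinitePi P 0 hF2) (iIndepFun_eval_infinitePi P hFm)
      (fun i => identDistrib_eval_infinitePi P hFm i)
    have h1 := ProbabilityMeasure.tendsto_iff_tendsto_charFun.1 hclt.tendsto 1
    simp only [ProbabilityMeasure.coe_mk] at h1
    have hlim : (fun ω' => inner ℝ (WithLp.toLp 2 fun j => Z (h j) ω' :
        EuclideanSpace ℝ (Fin k)) t) = W := by
      ext ω'
      simp [hW, PiLp.inner_apply]
    have hseq : ∀ n : ℕ, (fun ω => inner ℝ (Y n ω) t) = fun ω : ℕ → 𝒳 =>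
        (√n)⁻¹ * (∑ i ∈ Finset.range n, F (ω i) - n * ∫ ω, F (ω 0) ∂μ) := by
      intro n
      ext ω
      rw [integral_eval_infinitePi P 0 hFm.aestronglyMeasurable, hF0, mul_zero, sub_zero]
      simp only [hY, hF, PiLp.inner_apply, RCLike.inner_apply, conj_trivial]
      rw [Finset.sum_comm, Finset.mul_sum]
      refine Finset.sum_congr rfl fun j _ => ?_
      rw [← Finset.mul_sum]
      ring
    rw [hlim]
    simp_rw [hseq]
    exact h1
  exact hmain.continuous_comp (g := WithLp.ofLp) (PiLp.continuous_ofLp 2 _)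
end

/-! ### The score variables of the product model. -/

section
variable {𝒳 : Type*} [MeasurableSpace 𝒳]

/-- The product of `n` copies of `P` is the law of the first `n` coordinates under the infinite
product. -/
theorem measurePreserving_restrict_infinitePi (P : Measure 𝒳) [IsProbabilityMeasure P] (n : ℕ) :
    MeasurePreserving (fun (ω : ℕ → 𝒳) (i : Fin n) => ω i) (Measure.infinitePi fun _ : ℕ => P)
      (Measure.pi fun _ : Fin n => P) := by
  refine ⟨by fun_prop, ?_⟩
  rw [Measure.map_infinitePi_infinitePi_of_inj (P := fun _ : ℕ => P) Fin.val_injective,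
    Measure.infinitePi_eq_pi]

open Classical in
/-- The variable `G_n(h)` of the product experiment with `n` observations, along a path with
score `g` whose `n`-th alternative is `Q`: the normalized sum of `h`, except at `h = g`, where it is
the log-likelihood ratio plus `‖g‖² / 2`. -/
noncomputable def productScore (P Q : Measure 𝒳) [IsProbabilityMeasure P] (g : L20 P) (n : ℕ)
    (h : L20 P) (x : Fin n → 𝒳) : EReal :=
  if h = g then
    ENNReal.log ((Measure.pi fun _ : Fin n => Q).rnDeriv (Measure.pi fun _ : Fin n => P) x)
      + ((1 / 2 * ‖g‖ ^ 2 : ℝ) : EReal)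
  else (((√n)⁻¹ * ∑ i, (h : Lp ℝ 2 P) (x i) : ℝ) : EReal)

theorem measurable_productScore (P Q : Measure 𝒳) [IsProbabilityMeasure P] (g : L20 P) (n : ℕ)
    (h : L20 P) : Measurable (productScore P Q g n h) := by
  unfold productScore
  split_ifs
  · exact (ENNReal.measurable_log.comp (Measure.measurable_rnDeriv _ _)).add_const _
  · exact measurable_coe_real_ereal.comp ((Finset.measurable_sum _ fun i _ =>
      (measurable_coe_Lp _).comp (measurable_pi_apply i)).const_mul _)

theorem log_prod_eq_coe_sum_log {n : ℕ} {q : Fin n → ℝ≥0∞} (h0 : ∀ i, q i ≠ 0)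
    (ht : ∀ i, q i ≠ ⊤) : ENNReal.log (∏ i, q i) = ((∑ i, Real.log (q i).toReal : ℝ) : EReal) := by
  rw [ENNReal.log_pos_real (Finset.prod_ne_zero_iff.2 fun i _ => h0 i)
    (ENNReal.prod_ne_top fun i _ => ht i), ENNReal.toReal_prod,
    Real.log_prod fun i _ => (ENNReal.toReal_pos (h0 i) (ht i)).ne']

variable {P : Measure 𝒳} [IsProbabilityMeasure P] {Q : ℕ → Measure 𝒳}
  [∀ n, IsProbabilityMeasure (Q n)]

open Classical in
/-- The real-valued version of `productScore`. -/
noncomputable def realProductScore (P : Measure 𝒳) (Q : ℕ → Measure 𝒳) [IsProbabilityMeasure P]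
    (g : L20 P) (n : ℕ) (h : L20 P) (ω : ℕ → 𝒳) : ℝ :=
  if h = g then
    ∑ i ∈ Finset.range n, Real.log ((Q n).rnDeriv P (ω i)).toReal
      + 1 / 2 * ∫ x, (g : Lp ℝ 2 P) x ^ 2 ∂P
  else (√n)⁻¹ * ∑ i ∈ Finset.range n, (h : Lp ℝ 2 P) (ω i)

theorem measurable_realProductScore (Q : ℕ → Measure 𝒳) (g : L20 P) (n : ℕ) (h : L20 P) :
    Measurable (realProductScore P Q g n h) := by
  unfold realProductScore
  split_ifs
  · exact (Finset.measurable_sum _ fun i _ => (((Q n).measurable_rnDeriv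
      P).ennreal_toReal.log.comp (measurable_pi_apply i))).add_const _
  · exact (Finset.measurable_sum _ fun i _ =>
      (measurable_coe_Lp _).comp (measurable_pi_apply i)).const_mul _

theorem productScore_eq_coe_realProductScore (g : L20 P) (n : ℕ) :
    ∀ᵐ ω ∂(Measure.infinitePi fun _ : ℕ => P),
      (∀ i ∈ Finset.range n, |rootScore P (Q n) (ω i)| ≤ 1) → ∀ h,
        productScore P (Q n) g n h (fun i => ω i) = realProductScore P Q g n h ω := by
  have h1 := (measurePreserving_restrict_infinitePi P n).quasiMeasurePreserving.ae
    (rnDeriv_pi (ι := Fin n) P (Q n))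
  have h2 : ∀ᵐ ω ∂(Measure.infinitePi fun _ : ℕ => P), ∀ i : ℕ, (Q n).rnDeriv P (ω i) ≠ ⊤ :=
    ae_all_iff.2 fun i =>
      (measurePreserving_eval_infinitePi (fun _ : ℕ => P) i).quasiMeasurePreserving.ae
        ((Q n).rnDeriv_ne_top P)
  filter_upwards [h1, h2] with ω hω hfin hW h
  unfold productScore realProductScore
  split_ifs with hh
  -- A vanishing density would give `W = -2`, against `|W| ≤ 1`.
  · have h0 : ∀ i : Fin n, (Q n).rnDeriv P (ω i) ≠ 0 := by
      intro i hi
      have h3 := hW i (Finset.mem_range.2 i.2)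
      rw [rootScore, hi] at h3
      norm_num at h3
    rw [hω, log_prod_eq_coe_sum_log h0 fun i => hfin i, norm_sq_L20, ← EReal.coe_add,
      Fin.sum_univ_eq_sum_range (fun i => Real.log ((Q n).rnDeriv P (ω i)).toReal) n]
  · rw [Fin.sum_univ_eq_sum_range (fun i => (h : Lp ℝ 2 P) (ω i)) n]

/-- The vector differs from the normalized sums only in coordinates with `h_j = g`, always by the
same remainder, so one variable tending to `0` in probability controls the sup norm. -/
theorem tendstoInDistribution_realProductScore {Ω' : Type*} [MeasurableSpace Ω']
    {P' : Measure Ω'} [IsProbabilityMeasure P'] {S : Set (L20 P)} {Z : S → Ω' → ℝ}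
    (hZ : IsIsonormalOn S Z P') {g : L20 P}
    (hH : Tendsto (fun n : ℕ => hellingerIntegral (P + Q n) P (Q n) (√n)⁻¹ (g : Lp ℝ 2 P))
      atTop (𝓝 0)) {k : ℕ} (h : Fin k → S) :
    TendstoInDistribution (fun (n : ℕ) ω (j : Fin k) => realProductScore P Q g n (h j) ω) atTop
      (fun ω' j => Z (h j) ω') (fun _ => Measure.infinitePi fun _ : ℕ => P) P' := by
  refine tendstoInDistribution_of_tendstoInMeasure_sub _ _
    (tendstoInDistribution_normalized_sum_L20 hZ h) ?_
    fun n => (measurable_pi_iff.2 fun j => measurable_realProductScore Q g n (h j)).aemeasurable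
  have h1 := tendstoInMeasure_zero_iff_abs.1 (tendstoInMeasure_sum_log_rnDeriv
    (measurable_coe_Lp (g : Lp ℝ 2 P)) (Lp.memLp _) (mem_L20.1 g.2) hH)
  rw [tendstoInMeasure_iff_norm]
  intro ε hε
  refine tendsto_of_tendsto_of_tendsto_of_le_of_le tendsto_const_nhds (h1 ε hε)
    (fun _ => zero_le) fun n => measure_mono fun ω hω => ?_
  simp only [Set.mem_ofPred_eq, Pi.zero_apply, sub_zero] at hω ⊢
  by_contra! hc
  refine absurd hω (not_le.2 ((pi_norm_lt_iff hε).2 fun j => ?_))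
  simp only [Pi.sub_apply, realProductScore]
  split_ifs with hj
  · rw [hj]
    exact hc
  · rw [sub_self, norm_zero]
    exact hε

/-- The extended-real and real versions agree unless some `|W_i| > 1`, an event of vanishing
probability; the law then passes from `P^ℕ` to its first `n` coordinates. -/
theorem tendstoInDistribution_productScore {Ω' : Type*} [MeasurableSpace Ω']
    {P' : Measure Ω'} [IsProbabilityMeasure P'] {S : Set (L20 P)} {Z : S → Ω' → ℝ}
    (hZ : IsIsonormalOn S Z P') {g : L20 P}
    (hH : Tendsto (fun n : ℕ => hellingerIntegral (P + Q n) P (Q n) (√n)⁻¹ (g : Lp ℝ 2 P))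
      atTop (𝓝 0)) {k : ℕ} (h : Fin k → S) :
    TendstoInDistribution
      (fun (n : ℕ) (x : Fin n → 𝒳) (j : Fin k) => productScore P (Q n) g n (h j) x) atTop
      (fun ω' j => ((Z (h j) ω' : ℝ) : EReal)) (fun n => Measure.pi fun _ : Fin n => P) P' := by
  set μ := Measure.infinitePi fun _ : ℕ => P
  have hg : Measurable (g : Lp ℝ 2 P) := measurable_coe_Lp _
  have hcoe : Continuous fun (y : Fin k → ℝ) (j : Fin k) => ((y j : ℝ) : EReal) :=
    continuous_pi fun j => continuous_coe_real_ereal.comp (continuous_apply j)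
  have hGm : ∀ n, Measurable fun (x : Fin n → 𝒳) (j : Fin k) => productScore P (Q n) g n (h j) x :=
    fun n => measurable_pi_iff.2 fun j => measurable_productScore P (Q n) g n (h j)
  have hmp := measurePreserving_restrict_infinitePi P
  have h1 := (tendstoInDistribution_realProductScore hZ hH h).continuous_comp hcoe
  have h2 : TendstoInDistribution
      (fun (n : ℕ) (ω : ℕ → 𝒳) (j : Fin k) => productScore P (Q n) g n (h j) fun i => ω i) atTop
      (fun ω' j => ((Z (h j) ω' : ℝ) : EReal)) (fun _ => μ) P' := by
    refine tendstoInDistribution_of_tendsto_measure_ne h1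
      (fun n => ((hGm n).comp (hmp n).measurable).aemeasurable) ?_
    refine tendsto_of_tendsto_of_tendsto_of_le_of_le tendsto_const_nhds
      (tendsto_measure_exists_rootScore_gt hg (Lp.memLp _)
        (tendsto_integral_sq_scoreRemainder hg hH) one_pos) (fun _ => zero_le) fun n => ?_
    refine measure_mono_ae ?_
    filter_upwards [productScore_eq_coe_realProductScore (Q := Q) g n] with ω hω hne
    change ∃ i ∈ Finset.range n, 1 < |rootScore P (Q n) (ω i)|
    by_contra! hc
    exact hne (funext fun j => (hω hc (h j)).symm)
  refine ⟨fun n => (hGm n).aemeasurable, h2.aemeasurable_limit, ?_⟩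
  refine h2.tendsto.congr fun n => Subtype.ext ?_
  change μ.map _ = (Measure.pi fun _ : Fin n => P).map _
  rw [← (hmp n).map_eq, Measure.map_map (hGm n) (hmp n).measurable]
  rfl
end

/-! ### The product model is locally regular. -/

theorem mainTheorem10 {Θ 𝒳 E : Type*} [MeasurableSpace 𝒳]
    [NormedAddCommGroup E] [InnerProductSpace ℝ E] [CompleteSpace E]
    (P : Θ → Measure 𝒳) [∀ θ, IsProbabilityMeasure (P θ)]
    (θ : Θ) (T : TangentSet θ E) (A : T.lin →L[ℝ] L20 (P θ))
    (hA : HellingerRegular P T A) :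
    IsLocallyRegularIndirectModel (productModel P) T (fun n : ℕ+ => (√(n : ℝ))⁻¹) A := by
  have hlim : Tendsto (fun n : ℕ => (√(n : ℝ))⁻¹) atTop (𝓝 0) :=
    (Real.tendsto_sqrt_atTop.comp tendsto_natCast_atTop_atTop).inv_tendsto_atTop
  have hpos : ∀ n : ℕ+, 0 < (√(n : ℝ))⁻¹ := fun n => by
    have : (0 : ℝ) < (n : ℕ) := Nat.cast_pos.2 n.pos
    positivity
  refine ⟨hpos, fun m n hmn => ?_, hlim.comp tendsto_PNat_val_atTop_atTop, ?_⟩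
  · have h1 : (0 : ℝ) < (m : ℕ) := Nat.cast_pos.2 m.pos
    have h2 : ((m : ℕ) : ℝ) ≤ (n : ℕ) := Nat.cast_le.2 hmn
    exact inv_anti₀ (Real.sqrt_pos.2 h1) (Real.sqrt_le_sqrt h2)
  obtain ⟨Ω', mΩ', P', hP', Z, hZ⟩ := exists_isIsonormalOn (Set.range A)
  refine ⟨Ω', mΩ', P', hP', Z, hZ, fun b => ?_⟩
  set g := A (T.toLin b) with hg
  have hH : Tendsto (fun n : ℕ => hellingerIntegral (P θ + P (T.path b (√(n : ℝ))⁻¹)) (P θ)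
      (P (T.path b (√(n : ℝ))⁻¹)) (√(n : ℝ))⁻¹ (g : Lp ℝ 2 (P θ))) atTop (𝓝 0) := by
    refine (hA b).comp (tendsto_nhdsWithin_iff.2 ⟨hlim, ?_⟩)
    -- `n = 0` is excluded because there `(√0)⁻¹ = 0` is not positive.
    filter_upwards [eventually_gt_atTop 0] with n hn
    have : (0 : ℝ) < n := Nat.cast_pos.2 hn
    exact inv_pos.2 (Real.sqrt_pos.2 this)
  refine ⟨fun n h => productScore (P θ) (P (T.path b (√(n : ℝ))⁻¹)) g n (h : L20 (P θ)),
    fun n h => measurable_productScore _ _ _ _ _, fun n _ => ae_of_all _ fun x => ?_,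
    fun k h => ?_⟩
  · simp only [productScore]
    -- The added constant is real, so it cancels even where the logarithm is infinite.
    rw [if_pos hg.symm, ← hg, EReal.add_sub_cancel_right]
  · have h1 := tendstoInDistribution_productScore
      (Q := fun n : ℕ => P (T.path b (√(n : ℝ))⁻¹)) hZ hH h
    exact ⟨fun n => h1.forall_aemeasurable n, h1.aemeasurable_limit,
      h1.tendsto.comp tendsto_PNat_val_atTop_atTop⟩
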